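/- Let $X_2$ be the space of all lattices $L\subset\mathbb{R}^2$ of covolume one, with the topology of $\operatorname{SL}(2,\mathbb{R})/\operatorname{SL}(2,\mathbb{Z})$ transported by $g\mapsto g\mathbb{Z}^2$. There is a unique $\operatorname{SL}(2,\mathbb{R})$-invariant Borel probability measure $\mu_0$ on $X_2$. Let $$\Delta=\{x\in\mathbb{R}_{\ge 0}^2 : x_1+x_2\le 1\},$$ let $\rho(\Delta,L)=\inf\{r>0 : r\Delta+L=\mathbb{R}^2\}$ be the covering radius of $\Delta$ with respect to $L$, and put $$P_2(R)=\mu_0\bigl(\{L\in X_2 : \rho(\Delta,L)>R\}\bigr)\qquad(R\in\mathbb{R}).$$ Define, for $R\ge 0$, $$p_2(R)=\begin{cases}0 & (0\le R\le\sqrt3),\\[2pt] \dfrac{12}{\pi}\Bigl(\dfrac{R}{\sqrt3}-\sqrt{4-R^2}\Bigr) & (\sqrt3\le R\le 2),\\[6pt] \dfrac{12}{\pi^2}\Bigl(R\sqrt3\,\arccos\Bigl(\dfrac{R+3\sqrt{R^2-4}}{4\sqrt{R^2-3}}\Bigr)+\dfrac32\sqrt{R^2-4}\,\log\Bigl(\dfrac{R^2-4}{R^2-3}\Bigr)\Bigr)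 & (R>2).\end{cases}$$ Then $p_2$ is the probability density of $\rho(\Delta,L)$ for $L$ chosen at random in $X_2$ according to $\mu_0$. More precisely, for every $R\ge0$, $P_2$ is differentiable at $R$ with $-\frac{d}{dR}P_2(R)=p_2(R)$, and $p_2$ is integrable on $(R,\infty)$ with $P_2(R)=\int_R^\infty p_2(x)\,dx$. -/

import Mathlib

open MeasureTheory
open scoped Pointwise MatrixGroups

/-- The covering radius of a set `K ⊆ ℝᵏ` with respect to a lattice `L ⊆ ℝᵏ`: the infimum of all
`r > 0` such that the translates of `r K` by the vectors of `L` cover `ℝᵏ`. -/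
noncomputable def coveringRadius {k : ℕ} (K : Set (Fin k → ℝ)) (L : Submodule ℤ (Fin k → ℝ)) : ℝ :=
  sInf {r : ℝ | 0 < r ∧ r • K + (L : Set (Fin k → ℝ)) = Set.univ}

/-- The simplex `{x : x₁, …, x_k ≥ 0, x₁ + ⋯ + x_k ≤ 1}`. -/
def cornerSimplex (k : ℕ) : Set (Fin k → ℝ) :=
  {x | (∀ i, 0 ≤ x i) ∧ ∑ i, x i ≤ 1}

/-- The space `X_k` of all (full rank) lattices `L ⊆ ℝᵏ` of covolume one. -/
@[ext]
structure UnimodularLattice (k : ℕ) where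
  /-- the underlying lattice -/
  lattice : Submodule ℤ (Fin k → ℝ)
  /-- the lattice is discrete -/
  discrete : DiscreteTopology lattice
  /-- the lattice spans `ℝᵏ` over `ℝ` -/
  isZLattice : IsZLattice ℝ lattice
  /-- Lebesgue measure of a fundamental domain is one -/
  covolume_eq_one : ZLattice.covolume lattice volume = 1

namespace UnimodularLattice

variable {k : ℕ}

/-- The linear automorphism `v ↦ g v` of `ℝᵏ`, as a continuous linear equivalence. -/
noncomputable def slEquiv (g : SL(k, ℝ)) : (Fin k → ℝ) ≃L[ℝ] (Fin k → ℝ) :=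
  (Matrix.SpecialLinearGroup.toLin' g).toContinuousLinearEquiv

theorem slEquiv_apply (g : SL(k, ℝ)) (v : Fin k → ℝ) :
    slEquiv g v = Matrix.mulVec (g : Matrix (Fin k) (Fin k) ℝ) v := rfl

theorem measurePreserving_slEquiv (g : SL(k, ℝ)) :
    MeasurePreserving (slEquiv g) volume volume := by
  refine ⟨(slEquiv g).continuous.measurable, ?_⟩
  have h := Real.map_matrix_volume_pi_eq_smul_volume_pi
    (M := (g : Matrix (Fin k) (Fin k) ℝ)) (by simp)
  rw [Matrix.SpecialLinearGroup.det_coe] at h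
  simp only [inv_one, abs_one, ENNReal.ofReal_one, one_smul] at h
  exact h

/-- The group `SL(k, ℝ)` acts on `X_k` by `g • L = {g v : v ∈ L}`. -/
noncomputable instance : SMul SL(k, ℝ) (UnimodularLattice k) where
  smul g L :=
    haveI := L.discrete
    haveI := L.isZLattice
    { lattice := ZLattice.comap ℝ L.lattice (slEquiv g⁻¹).toLinearMap
      discrete := inferInstance
      isZLattice := inferInstance
      covolume_eq_one := by
        rw [ZLattice.covolume_comap L.lattice volume volume (measurePreserving_slEquiv g⁻¹)]
        exact L.covolume_eq_one }

theorem mem_smul_iff_inv (g : SL(k, ℝ)) (L : UnimodularLattice k) (v : Fin k → ℝ) :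
    v ∈ (g • L).lattice ↔
      Matrix.mulVec ((g⁻¹ : SL(k, ℝ)) : Matrix (Fin k) (Fin k) ℝ) v ∈ L.lattice := Iff.rfl

theorem coe_smul_lattice (g : SL(k, ℝ)) (L : UnimodularLattice k) :
    ((g • L).lattice : Set (Fin k → ℝ)) =
      (fun v => Matrix.mulVec (g : Matrix (Fin k) (Fin k) ℝ) v) '' (L.lattice : Set _) := by
  ext v
  simp only [SetLike.mem_coe, mem_smul_iff_inv, Set.mem_image]
  constructor
  · intro h
    refine ⟨_, h, ?_⟩
    rw [Matrix.mulVec_mulVec, ← Matrix.SpecialLinearGroup.coe_mul, mul_inv_cancel]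
    simp
  · rintro ⟨w, hw, rfl⟩
    rw [Matrix.mulVec_mulVec, ← Matrix.SpecialLinearGroup.coe_mul, inv_mul_cancel]
    simpa using hw

noncomputable instance : MulAction SL(k, ℝ) (UnimodularLattice k) where
  one_smul L := by
    ext v
    rw [mem_smul_iff_inv]
    simp
  mul_smul g h L := by
    ext v
    simp only [mem_smul_iff_inv]
    rw [mul_inv_rev, Matrix.mulVec_mulVec, Matrix.SpecialLinearGroup.coe_mul]

/-- The standard lattice `ℤᵏ`. -/
noncomputable def std (k : ℕ) : UnimodularLattice k where
  lattice := Submodule.span ℤ (Set.range (Pi.basisFun ℝ (Fin k)))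
  discrete := inferInstance
  isZLattice := inferInstance
  covolume_eq_one := by
    rw [ZLattice.covolume_eq_measure_fundamentalDomain _ _
      (ZSpan.isAddFundamentalDomain (Pi.basisFun ℝ (Fin k)) volume)]
    simp [ZSpan.fundamentalDomain_pi_basisFun, measureReal_def, Real.volume_pi_Ico]

/-- The quotient topology on `X_k ≅ SL(k, ℝ) / SL(k, ℤ)`, coming from the surjection
`g ↦ g • ℤᵏ`. -/
noncomputable instance : TopologicalSpace (UnimodularLattice k) :=
  TopologicalSpace.coinduced (fun g : SL(k, ℝ) => g • std k) inferInstance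

/-- The Borel sigma-algebra on `X_k`. -/
noncomputable instance : MeasurableSpace (UnimodularLattice k) := borel _

instance : BorelSpace (UnimodularLattice k) := ⟨rfl⟩

/-- `μ` is an `SL(k, ℝ)`-invariant Borel probability measure on `X_k`. -/
def IsInvariantProbability (μ : Measure (UnimodularLattice k)) : Prop :=
  IsProbabilityMeasure μ ∧ SMulInvariantMeasure SL(k, ℝ) (UnimodularLattice k) μ

/-- The complementary distribution function `R ↦ μ {L ∈ X_k : ρ(Δ, L) > R}` of the covering radius
of the simplex `Δ` with respect to a `μ`-random lattice `L`. -/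
noncomputable def coveringRadiusTail (μ : Measure (UnimodularLattice k)) (R : ℝ) : ℝ :=
  μ.real {L | R < coveringRadius (cornerSimplex k) L.lattice}

end UnimodularLattice

/-- The explicit density `p₂`. -/
noncomputable def ustinovDensity (R : ℝ) : ℝ :=
  if R ≤ √3 then 0
  else if R ≤ 2 then 12 / Real.pi * (R / √3 - √(4 - R ^ 2))
  else 12 / Real.pi ^ 2 *
    (R * √3 * Real.arccos ((R + 3 * √(R ^ 2 - 4)) / (4 * √(R ^ 2 - 3))) +
      3 / 2 * √(R ^ 2 - 4) * Real.log ((R ^ 2 - 4) / (R ^ 2 - 3)))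

/-! ### A Haar measure on `SL(2, ℝ)` -/

/-! Almost every lattice has exactly one basis $u=(a,-e)$, $v=(-f,b)$ with $0<e,f<a,b$: $u$ is the
lattice vector with least first coordinate in the cone $y<0<x+y$, and $v$ the one with least second
coordinate in $x<0<x+y$ (`reducedDomain_injOn`, `exists_mul_mem_reducedDomain`). So the matrices
with such columns form a fundamental domain for right multiplication by $SL(2,\mathbb Z)$, and
normalised Haar measure on it descends to an invariant probability. In this basis the covering
radius is $a+b-\min(e,f)$ (`coveringRadius_smul_std`).

The rest is integration against the Haar measure $|a|^{-1}\,da\,de\,df$. Transposition exchanges $e$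
and $f$, so take $e<f$. Trading $f$ for $R=a+b-e$ gives the measure $e^{-1}\,dR\,de\,da$. For fixed
$R,e$ and $\tau=a-b$ the domain becomes $\tau^2<q(e)$ and $(\tau\pm e)^2>R^2-4$, where
$q(e)=R^2+2Re-3e^2-4$. Since $\max q=\frac43(R^2-3)$, nothing survives for $R\le\sqrt3$; the other
two conditions are void for $R<2$. This is the source of the three cases of the density
(`lintegral_volume_sectionSet`). The total mass $\pi^2/6$ is found separately, through $\sum n^{-2}$
(`sl2Haar_reducedDomain`). The density is continuous, so the tail is differentiable everywhere by
the fundamental theorem of calculus.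

For uniqueness, Fubini shows that any invariant probability lives on lattices with a reduced basis.
Summing its copies over $SL(2,\mathbb Z)$ lifts it to a σ-finite left-invariant measure on
$SL(2,\mathbb R)$, which must be proportional to Haar measure. -/

noncomputable instance : MeasurableSpace SL(2, ℝ) := borel _

instance : BorelSpace SL(2, ℝ) := ⟨rfl⟩

instance : SecondCountableTopology SL(2, ℝ) :=
  haveI : SecondCountableTopology (Matrix (Fin 2) (Fin 2) ℝ) :=
    inferInstanceAs (SecondCountableTopology (Fin 2 → Fin 2 → ℝ))
  Topology.IsInducing.secondCountableTopology
    (f := fun g : SL(2, ℝ) => (g : Matrix (Fin 2) (Fin 2) ℝ)) ⟨rfl⟩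

theorem lintegral_comp_affine {F : ℝ → ENNReal} {k : ℝ} (hk : k ≠ 0) (l : ℝ) :
    ∫⁻ x, F (k * x + l) = ENNReal.ofReal |k⁻¹| * ∫⁻ x, F x := by
  have h1 : ∫⁻ x, F (k * x + l) = ∫⁻ x, F (x + l) ∂(Measure.map (fun x => k * x) volume) :=
    ((Homeomorph.mulLeft₀ k hk).measurableEmbedding.lintegral_map (μ := volume)
      (fun x => F (x + l))).symm
  rw [h1, Real.map_volume_mul_left hk, lintegral_smul_measure, smul_eq_mul,
    lintegral_add_right_eq_self]

/-- The unimodular matrix with first row `(a, -f)` and first column `(a, -e)`. -/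
noncomputable def sl2Coord (p : ℝ × ℝ × ℝ) : SL(2, ℝ) :=
  if h : p.1 ≠ 0 then
    ⟨!![p.1, -p.2.2; -p.2.1, (1 + p.2.1 * p.2.2) / p.1], by
      rw [Matrix.det_fin_two_of]; field_simp; ring⟩
  -- The value on $a=0$ is immaterial: the weight $|a|^{-1}$ of the Haar measure is $0$ there.
  else 1

theorem coe_sl2Coord {a : ℝ} (ha : a ≠ 0) (e f : ℝ) :
    (sl2Coord (a, e, f) : Matrix (Fin 2) (Fin 2) ℝ) = !![a, -f; -e, (1 + e * f) / a] := by
  simp [sl2Coord, ha]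

theorem sl2Coord_eq {a : ℝ} (ha : a ≠ 0) {e f : ℝ} {g : SL(2, ℝ)} (h0 : g 0 0 = a)
    (h1 : g 0 1 = -f) (h2 : g 1 0 = -e) : g = sl2Coord (a, e, f) := by
  have hd : g 0 0 * g 1 1 - g 0 1 * g 1 0 = 1 := by
    rw [← Matrix.det_fin_two]; exact g.2
  have h3 : g 1 1 = (1 + e * f) / a := by
    rw [h0, h1, h2] at hd
    field_simp
    linarith
  ext i j
  rw [coe_sl2Coord ha]
  fin_cases i <;> fin_cases j
  · exact h0
  · exact h1
  · exact h2
  · exact h3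

theorem measurable_sl2Coord : Measurable sl2Coord := by
  classical
  have hs : MeasurableSet {p : ℝ × ℝ × ℝ | p.1 ≠ 0} :=
    (measurableSet_singleton (0 : ℝ)).compl.preimage measurable_fst
  have h : sl2Coord = Set.piecewise {p : ℝ × ℝ × ℝ | p.1 ≠ 0} sl2Coord (fun _ => 1) := by
    ext1 p
    by_cases hp : p ∈ {p : ℝ × ℝ × ℝ | p.1 ≠ 0}
    · exact (Set.piecewise_eq_of_mem _ _ _ hp).symm
    · rw [Set.piecewise_eq_of_notMem _ _ _ hp]
      exact dif_neg hp
  rw [h]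
  refine ContinuousOn.measurable_piecewise ?_ continuousOn_const hs
  have hi : Topology.IsInducing (fun g : SL(2, ℝ) => (g : Matrix (Fin 2) (Fin 2) ℝ)) := ⟨rfl⟩
  rw [hi.continuousOn_iff]
  have h2 : ContinuousOn (fun p : ℝ × ℝ × ℝ =>
      !![p.1, -p.2.2; -p.2.1, (1 + p.2.1 * p.2.2) / p.1]) {p | p.1 ≠ 0} := by
    refine continuousOn_pi.2 fun i => continuousOn_pi.2 fun j => ?_
    fin_cases i <;> fin_cases j
    · exact continuous_fst.continuousOn
    · exact (continuous_snd.comp continuous_snd).neg.continuousOn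
    · exact (continuous_fst.comp continuous_snd).neg.continuousOn
    · exact ContinuousOn.div (by fun_prop) (by fun_prop) fun p hp => hp
  refine h2.congr fun p hp => ?_
  exact coe_sl2Coord hp _ _

/-- A Haar measure on `SL(2, ℝ)`. -/
noncomputable def sl2Haar : Measure SL(2, ℝ) :=
  ((volume : Measure (ℝ × ℝ × ℝ)).withDensity fun p => ENNReal.ofReal |p.1|⁻¹).map sl2Coord

instance : SFinite sl2Haar := by unfold sl2Haar; infer_instance

theorem lintegral_sl2Haar {φ : SL(2, ℝ) → ENNReal} (hφ : Measurable φ) :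
    ∫⁻ g, φ g ∂sl2Haar =
      ∫⁻ a : ℝ, ∫⁻ e : ℝ, ∫⁻ f : ℝ, ENNReal.ofReal |a|⁻¹ * φ (sl2Coord (a, e, f)) := by
  have hw : Measurable fun p : ℝ × ℝ × ℝ => ENNReal.ofReal |p.1|⁻¹ := by fun_prop
  have hψ : Measurable fun p => φ (sl2Coord p) := hφ.comp measurable_sl2Coord
  have hm := hw.mul hψ
  rw [sl2Haar, lintegral_map hφ measurable_sl2Coord,
    lintegral_withDensity_eq_lintegral_mul _ hw hψ,
    Measure.volume_eq_prod, lintegral_prod _ hm.aemeasurable]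
  refine lintegral_congr fun a => ?_
  rw [Measure.volume_eq_prod]
  exact lintegral_prod (fun q => ENNReal.ofReal |a|⁻¹ * φ (sl2Coord (a, q)))
    (hm.comp measurable_prodMk_left).aemeasurable

theorem map_eq_sl2Haar_of_lintegral {T : SL(2, ℝ) → SL(2, ℝ)} (hT : Measurable T)
    (h : ∀ φ : SL(2, ℝ) → ENNReal, Measurable φ →
      ∫⁻ g, φ (T g) ∂sl2Haar = ∫⁻ g, φ g ∂sl2Haar) : sl2Haar.map T = sl2Haar := by
  refine Measure.ext fun s hs => ?_
  have h1 := h (s.indicator 1) (measurable_one.indicator hs)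
  rw [lintegral_indicator_one hs] at h1
  rw [Measure.map_apply hT hs, ← h1, ← lintegral_indicator_one (hT hs)]
  rfl

/-- Lower unipotent matrices. -/
def lowerUnipotent (t : ℝ) : SL(2, ℝ) := ⟨!![1, 0; t, 1], by simp⟩

/-- The Weyl element of `SL(2, ℝ)`. -/
def weylElement : SL(2, ℝ) := ⟨!![0, 1; -1, 0], by simp⟩

@[simp]
theorem coe_lowerUnipotent (t : ℝ) :
    (lowerUnipotent t : Matrix (Fin 2) (Fin 2) ℝ) = !![1, 0; t, 1] := rfl

@[simp]
theorem coe_weylElement : (weylElement : Matrix (Fin 2) (Fin 2) ℝ) = !![0, 1; -1, 0] := rfl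

/-- The action fixes $a$ and $f$ and translates $e$ by $-ta$. -/
theorem map_lowerUnipotent_mul_sl2Haar (t : ℝ) :
    sl2Haar.map (lowerUnipotent t * ·) = sl2Haar := by
  refine map_eq_sl2Haar_of_lintegral (measurable_const_mul _) fun φ hφ => ?_
  rw [lintegral_sl2Haar (φ := fun g => φ (lowerUnipotent t * g)) (hφ.comp (measurable_const_mul _)),
    lintegral_sl2Haar hφ]
  refine lintegral_congr fun a => ?_
  by_cases ha : a = 0
  · simp [ha]
  rw [← lintegral_add_right_eq_self _ (t * a)]
  refine lintegral_congr fun e => lintegral_congr fun f => ?_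
  congr 2
  refine sl2Coord_eq ha ?_ ?_ ?_ <;>
    simp [coe_sl2Coord ha, Matrix.mul_apply, Fin.sum_univ_two]

/-- The coordinates $(a,e,f)$ go to $(-e,a,-(1+ef)/a)$. The last one is affine in $f$ with slope
$-e/a$, and this Jacobian turns the weight $|a|^{-1}$ into $|e|^{-1}$; exchanging $a$ with $e$ and
changing a sign finishes. -/
theorem map_weylElement_mul_sl2Haar : sl2Haar.map (weylElement * ·) = sl2Haar := by
  refine map_eq_sl2Haar_of_lintegral (measurable_const_mul _) fun φ hφ => ?_
  rw [lintegral_sl2Haar (φ := fun g => φ (weylElement * g)) (hφ.comp (measurable_const_mul _)),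
    lintegral_sl2Haar hφ]
  have hne : ∀ᵐ a : ℝ, a ≠ 0 := by simp [ae_iff]
  have key : ∀ᵐ a : ℝ, (∫⁻ e : ℝ, ∫⁻ f : ℝ, ENNReal.ofReal |a|⁻¹ *
      φ (weylElement * sl2Coord (a, e, f))) =
      ∫⁻ e : ℝ, ∫⁻ y : ℝ, ENNReal.ofReal |-e|⁻¹ * φ (sl2Coord (-e, a, y)) := by
    filter_upwards [hne] with a ha
    refine lintegral_congr_ae ?_
    filter_upwards [hne] with e he
    have hk : -(e / a) ≠ 0 := neg_ne_zero.2 (div_ne_zero he ha)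
    have h1 : ∀ f, φ (weylElement * sl2Coord (a, e, f)) =
        φ (sl2Coord (-e, a, -(e / a) * f + -a⁻¹)) := by
      intro f
      congr 1
      refine sl2Coord_eq (neg_ne_zero.2 he) ?_ ?_ ?_ <;>
        simp [coe_sl2Coord ha, Matrix.mul_apply, Fin.sum_univ_two]
      field_simp
    have hmeas : Measurable fun y => φ (sl2Coord (-e, a, y)) :=
      hφ.comp (measurable_sl2Coord.comp (by fun_prop))
    simp_rw [h1]
    rw [lintegral_const_mul', lintegral_comp_affine (F := fun y => φ (sl2Coord (-e, a, y))) hk,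
      lintegral_const_mul', ← mul_assoc, ← ENNReal.ofReal_mul (by positivity)]
    · congr 2
      rw [abs_inv, abs_neg, abs_neg, abs_div]
      have := abs_ne_zero.2 ha
      have := abs_ne_zero.2 he
      field_simp
    · exact ENNReal.ofReal_ne_top
    · exact ENNReal.ofReal_ne_top
  rw [lintegral_congr_ae key, lintegral_lintegral_swap]
  · rw [← lintegral_neg_eq_self]
    simp only [neg_neg]
  · refine Measurable.aemeasurable ?_
    have : Measurable fun p : (ℝ × ℝ) × ℝ =>
        ENNReal.ofReal |-p.1.2|⁻¹ * φ (sl2Coord (-p.1.2, p.1.1, p.2)) :=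
      Measurable.mul (by fun_prop) (hφ.comp (measurable_sl2Coord.comp (by fun_prop)))
    exact this.lintegral_prod_right'

/-- A matrix with lower left entry $c\ne0$ is upper unipotent times lower unipotent times upper
unipotent, and upper unipotents are Weyl conjugates of lower ones. If $c=0$, multiplying by the Weyl
element makes it nonzero. -/
theorem weylElement_generates (H : Subgroup SL(2, ℝ)) (hw : weylElement ∈ H)
    (hn : ∀ t, lowerUnipotent t ∈ H) (g : SL(2, ℝ)) : g ∈ H := by
  have key : ∀ g : SL(2, ℝ), g 1 0 ≠ 0 → g ∈ H := by
    intro g hg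
    have hd : g 0 0 * g 1 1 - g 0 1 * g 1 0 = 1 := by
      rw [← Matrix.det_fin_two]; exact g.2
    have h : g = (weylElement * lowerUnipotent (-((g 0 0 - 1) / g 1 0)) * weylElement⁻¹) *
        lowerUnipotent (g 1 0) *
        (weylElement * lowerUnipotent (-((g 1 1 - 1) / g 1 0)) * weylElement⁻¹) := by
      ext i j
      fin_cases i <;> fin_cases j <;>
        simp [Matrix.mul_apply, Fin.sum_univ_two,
          Matrix.SpecialLinearGroup.coe_inv, Matrix.adjugate_fin_two] <;> field_simp <;>
        linarith
    rw [h]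
    exact H.mul_mem (H.mul_mem (H.mul_mem (H.mul_mem hw (hn _)) (H.inv_mem hw)) (hn _))
      (H.mul_mem (H.mul_mem hw (hn _)) (H.inv_mem hw))
  by_cases hg : g 1 0 = 0
  · have hd : g 0 0 * g 1 1 - g 0 1 * g 1 0 = 1 := by
      rw [← Matrix.det_fin_two]; exact g.2
    have h1 : (weylElement * g) 1 0 ≠ 0 := by
      have h2 : (weylElement * g) 1 0 = -g 0 0 := by
        simp [Matrix.mul_apply, Fin.sum_univ_two]
      rw [h2, neg_ne_zero]
      rintro h
      simp [h, hg] at hd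
    exact (H.mul_mem_cancel_left hw).1 (key _ h1)
  · exact key g hg

instance : sl2Haar.IsMulLeftInvariant where
  map_mul_left_eq_self g := by
    let H : Subgroup SL(2, ℝ) :=
      { carrier := {h | sl2Haar.map (h * ·) = sl2Haar}
        one_mem' := by simp [Measure.map_id']
        mul_mem' := by
          intro a b ha hb
          change _ = _ at ha hb ⊢
          have : (fun x => a * b * x) = (a * ·) ∘ (b * ·) := by ext1 x; simp [mul_assoc]
          rw [this, ← Measure.map_map (measurable_const_mul _) (measurable_const_mul _), hb, ha]
        inv_mem' := by
          intro a ha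
          change _ = _ at ha ⊢
          conv_lhs => rw [← ha]
          rw [Measure.map_map (measurable_const_mul _) (measurable_const_mul _)]
          simp [Function.comp_def, Measure.map_id'] }
    exact weylElement_generates H map_weylElement_mul_sl2Haar map_lowerUnipotent_mul_sl2Haar g

theorem continuous_sl2_transpose :
    Continuous (Matrix.SpecialLinearGroup.transpose : SL(2, ℝ) → SL(2, ℝ)) := by
  refine continuous_induced_rng.mpr ?_
  exact Continuous.matrix_transpose continuous_induced_dom

theorem map_transpose_sl2Haar :
    sl2Haar.map Matrix.SpecialLinearGroup.transpose = sl2Haar := by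
  have hT := continuous_sl2_transpose.measurable
  refine map_eq_sl2Haar_of_lintegral hT fun φ hφ => ?_
  rw [lintegral_sl2Haar (φ := fun g => φ g.transpose) (hφ.comp hT), lintegral_sl2Haar hφ]
  refine lintegral_congr fun a => ?_
  by_cases ha : a = 0
  · simp [ha]
  rw [lintegral_lintegral_swap]
  · refine lintegral_congr fun e => lintegral_congr fun f => ?_
    congr 2
    refine sl2Coord_eq ha ?_ ?_ ?_ <;> simp [coe_sl2Coord ha]
  · refine Measurable.aemeasurable ?_
    exact Measurable.mul measurable_const
      ((hφ.comp hT).comp (measurable_sl2Coord.comp (by fun_prop)))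

/-- Transposition is a measure-preserving anti-automorphism, so it carries left invariance to right
invariance. -/
instance : sl2Haar.IsMulRightInvariant where
  map_mul_right_eq_self g := by
    have hT := continuous_sl2_transpose.measurable
    have h : (fun x => x * g) = Matrix.SpecialLinearGroup.transpose ∘
        (g.transpose * ·) ∘ Matrix.SpecialLinearGroup.transpose := by
      ext1 x
      apply Subtype.ext
      simp [Matrix.transpose_mul]
    rw [h, ← Measure.map_map hT ((measurable_const_mul _).comp hT),
      ← Measure.map_map (measurable_const_mul _) hT, map_transpose_sl2Haar,
      map_mul_left_eq_self, map_transpose_sl2Haar]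

/-! ### Lattices as orbits of the standard lattice -/

theorem sl2_det (g : SL(2, ℝ)) : g 0 0 * g 1 1 - g 0 1 * g 1 0 = 1 := by
  rw [← Matrix.det_fin_two]; exact g.2

namespace UnimodularLattice

theorem mem_std_iff (v : Fin 2 → ℝ) :
    v ∈ (std 2).lattice ↔ ∃ p q : ℤ, v 0 = p ∧ v 1 = q := by
  change v ∈ Submodule.span ℤ (Set.range (Pi.basisFun ℝ (Fin 2))) ↔ _
  rw [Module.Basis.mem_span_iff_repr_mem]
  simp only [Pi.basisFun_repr, Fin.forall_fin_two]
  constructor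
  · rintro ⟨⟨p, hp⟩, ⟨q, hq⟩⟩
    exact ⟨p, q, by simpa using hp.symm, by simpa using hq.symm⟩
  · rintro ⟨p, q, hp, hq⟩
    exact ⟨⟨p, by simp [hp]⟩, ⟨q, by simp [hq]⟩⟩

theorem mem_smul_std_iff (g : SL(2, ℝ)) (v : Fin 2 → ℝ) :
    v ∈ (g • std 2).lattice ↔
      ∃ p q : ℤ, v 0 = g 0 0 * p + g 0 1 * q ∧ v 1 = g 1 0 * p + g 1 1 * q := by
  rw [mem_smul_iff_inv, mem_std_iff]
  have hd := sl2_det g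
  refine exists_congr fun p => exists_congr fun q => ?_
  simp only [Matrix.SpecialLinearGroup.coe_inv, Matrix.adjugate_fin_two, Matrix.mulVec,
    dotProduct, Fin.sum_univ_two, Matrix.of_apply, Matrix.cons_val', Matrix.cons_val_zero,
    Matrix.cons_val_one, Matrix.cons_val_fin_one]
  constructor
  · rintro ⟨h1, h2⟩
    rw [← h1, ← h2]
    constructor
    · linear_combination (-(v 0)) * hd
    · linear_combination (-(v 1)) * hd
  · rintro ⟨h1, h2⟩
    rw [h1, h2]
    constructor
    · linear_combination (p : ℝ) * hd
    · linear_combination (q : ℝ) * hd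

end UnimodularLattice

/-- The image of `SL(2, ℤ)` in `SL(2, ℝ)`. -/
def sl2Int : Subgroup SL(2, ℝ) := (Matrix.SpecialLinearGroup.map (Int.castRingHom ℝ)).range

instance : Countable sl2Int :=
  haveI : Countable (Matrix (Fin 2) (Fin 2) ℤ) := inferInstanceAs (Countable (Fin 2 → Fin 2 → ℤ))
  haveI : Countable SL(2, ℤ) := Subtype.countable
  (Set.countable_range (Matrix.SpecialLinearGroup.map (n := Fin 2) (Int.castRingHom ℝ))).to_subtype

theorem mem_sl2Int_iff (γ : SL(2, ℝ)) : γ ∈ sl2Int ↔ ∀ i j, ∃ n : ℤ, γ i j = n := by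
  constructor
  · rintro ⟨δ, rfl⟩ i j
    exact ⟨δ i j, by simp⟩
  · intro h
    choose n hn using h
    have hdet : (Matrix.of n).det = 1 := by
      have hd := sl2_det γ
      rw [Matrix.det_fin_two]
      simp only [hn] at hd
      simp only [Matrix.of_apply]
      exact_mod_cast hd
    refine ⟨⟨Matrix.of n, hdet⟩, ?_⟩
    ext i j
    exact (hn i j).symm

namespace UnimodularLattice

theorem smul_std_eq_std_iff (γ : SL(2, ℝ)) : γ • std 2 = std 2 ↔ γ ∈ sl2Int := by
  constructor
  · intro h
    rw [mem_sl2Int_iff]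
    have h1 : ∀ p q : ℤ, (![γ 0 0 * p + γ 0 1 * q, γ 1 0 * p + γ 1 1 * q] : Fin 2 → ℝ) ∈
        (std 2).lattice := by
      intro p q
      rw [← h, mem_smul_std_iff]
      exact ⟨p, q, by simp, by simp⟩
    obtain ⟨a, c, ha, hc⟩ := (mem_std_iff _).1 (h1 1 0)
    obtain ⟨b, d, hb, hd⟩ := (mem_std_iff _).1 (h1 0 1)
    simp at ha hb hc hd
    intro i j
    fin_cases i <;> fin_cases j
    exacts [⟨a, ha⟩, ⟨b, hb⟩, ⟨c, hc⟩, ⟨d, hd⟩]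
  · intro h
    have key : ∀ γ ∈ sl2Int, ∀ v, v ∈ (γ • std 2).lattice → v ∈ (std 2).lattice := by
      intro γ h v hv
      rw [mem_sl2Int_iff] at h
      choose n hn using h
      obtain ⟨p, q, hp, hq⟩ := (mem_smul_std_iff _ _).1 hv
      refine (mem_std_iff _).2 ⟨n 0 0 * p + n 0 1 * q, n 1 0 * p + n 1 1 * q, ?_, ?_⟩
      · rw [hp, hn, hn]; push_cast; rfl
      · rw [hq, hn, hn]; push_cast; rfl
    ext v
    refine ⟨key γ h v, fun hv => ?_⟩
    rw [mem_smul_iff_inv]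
    refine key γ⁻¹ (inv_mem h) _ ?_
    rw [mem_smul_iff_inv, inv_inv, Matrix.mulVec_mulVec, ← Matrix.SpecialLinearGroup.coe_mul,
      mul_inv_cancel]
    simpa using hv

theorem smul_std_eq_smul_std_iff (g h : SL(2, ℝ)) :
    g • std 2 = h • std 2 ↔ g⁻¹ * h ∈ sl2Int := by
  rw [← smul_std_eq_std_iff, mul_smul, inv_smul_eq_iff, eq_comm]

/-- Covolume one makes the determinant of a basis $\pm1$; swapping the two vectors corrects the
sign. -/
theorem exists_smul_std_eq (L : UnimodularLattice 2) : ∃ g : SL(2, ℝ), g • std 2 = L := by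
  have := L.discrete
  have := L.isZLattice
  have := ZLattice.module_free ℝ L.lattice
  have := ZLattice.module_finite ℝ L.lattice
  have hr : Module.finrank ℤ L.lattice = 2 := by
    rw [ZLattice.rank ℝ L.lattice]; simp
  obtain ⟨b, hb⟩ : ∃ b : Module.Basis (Fin 2) ℤ L.lattice,
      (Matrix.of (Subtype.val ∘ b)).det = 1 := by
    let b := Module.finBasisOfFinrankEq ℤ L.lattice hr
    have h1 := ZLattice.covolume_eq_det L.lattice b
    rw [L.covolume_eq_one] at h1
    rcases eq_or_eq_neg_of_abs_eq h1.symm with h | h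
    · exact ⟨b, h⟩
    · refine ⟨b.reindex (Equiv.swap 0 1), ?_⟩
      rw [Matrix.det_fin_two] at h ⊢
      simp at h ⊢
      linarith
  obtain ⟨g, hg⟩ : ∃ g : SL(2, ℝ), ∀ i j, g i j = (b j : Fin 2 → ℝ) i :=
    ⟨⟨(Matrix.of (Subtype.val ∘ b)).transpose, by rw [Matrix.det_transpose, hb]⟩, fun _ _ => rfl⟩
  refine ⟨g, ?_⟩
  ext v
  rw [mem_smul_std_iff]
  simp only [hg]
  constructor
  · rintro ⟨p, q, hp, hq⟩
    have : v = ((p • b 0 + q • b 1 : L.lattice) : Fin 2 → ℝ) := by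
      ext i
      fin_cases i
      · simp [hp, mul_comm]
      · simp [hq, mul_comm]
    rw [this]
    exact Subtype.prop _
  · intro hv
    have h := b.sum_repr ⟨v, hv⟩
    rw [Fin.sum_univ_two] at h
    have h' : v = ((b.repr ⟨v, hv⟩ 0 • b 0 + b.repr ⟨v, hv⟩ 1 • b 1 : L.lattice) :
      Fin 2 → ℝ) := by rw [h]
    refine ⟨b.repr ⟨v, hv⟩ 0, b.repr ⟨v, hv⟩ 1, ?_, ?_⟩
    · have := congrFun h' 0
      rw [this]
      simp [mul_comm]
    · have := congrFun h' 1
      rw [this]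
      simp [mul_comm]

end UnimodularLattice

/-! ### Reduced bases -/

/-- Unimodular matrices with columns `(a, -e)` and `(-f, b)` such that `0 < e, f < a, b`. -/
def reducedDomain : Set SL(2, ℝ) :=
  {g | (0 < -g 1 0 ∧ 0 < -g 0 1) ∧ (-g 1 0 < g 0 0 ∧ -g 1 0 < g 1 1) ∧
    (-g 0 1 < g 0 0 ∧ -g 0 1 < g 1 1)}

/-! ### Uniqueness of the reduced basis -/

/-- The hypotheses say that $pu+qv$ lies in the cone $y<0<x+y$; among such vectors $u$ alone
minimises $x$. The cone excludes $p\le0$. For $q\le0<p$ the bound is immediate. For $p,q>0$, $qb<pe$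
and $e<b$ force $q\le p-1$, hence $x\ge(q+1)a-qf>a$. -/
theorem reduced_min {a b e f : ℝ} (he : 0 < e) (hf : 0 < f) (hea : e < a) (heb : e < b)
    (hfa : f < a) (hfb : f < b) {p q : ℤ} (h1 : q * b - p * e < 0)
    (h2 : 0 < p * (a - e) + q * (b - f)) :
    a ≤ p * a - q * f ∧ (p * a - q * f ≤ a → p = 1 ∧ q = 0) := by
  rcases le_or_gt p 0 with hp | hp
  · exfalso
    have hp' : (p : ℝ) ≤ 0 := by exact_mod_cast hp
    have hq' : (q : ℝ) < 0 := by
      by_contra hq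
      push Not at hq
      nlinarith [mul_nonneg hq (he.trans heb).le, mul_nonneg (neg_nonneg.2 hp') he.le]
    nlinarith [mul_nonneg (neg_nonneg.2 hp') (sub_pos.2 hea).le,
      mul_pos (neg_pos.2 hq') (sub_pos.2 hfb)]
  · have hp' : (1 : ℝ) ≤ p := by exact_mod_cast hp
    have ha : 0 < a := he.trans hea
    rcases le_or_gt q 0 with hq | hq
    · have hq' : (q : ℝ) ≤ 0 := by exact_mod_cast hq
      have h3 := mul_nonneg (sub_nonneg.2 hp') ha.le
      have h4 := mul_nonneg (neg_nonneg.2 hq') hf.le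
      refine ⟨by nlinarith, fun h => ?_⟩
      have h5 : (p - 1 : ℝ) * a = 0 := by nlinarith
      have h6 : -(q : ℝ) * f = 0 := by nlinarith
      rcases mul_eq_zero.1 h5 with h5 | h5
      · rcases mul_eq_zero.1 h6 with h6 | h6
        · refine ⟨?_, ?_⟩
          · have : (p : ℝ) = 1 := by linarith
            exact_mod_cast this
          · have : (q : ℝ) = 0 := by linarith
            exact_mod_cast this
        · linarith
      · linarith
    · have hq' : (1 : ℝ) ≤ q := by exact_mod_cast hq
      have h3 : (q : ℝ) < p := by
        by_contra h
        push Not at h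
        nlinarith [mul_nonneg (sub_nonneg.2 h) he.le, mul_pos (sub_pos.2 heb) (zero_lt_one.trans_le hq')]
      have h4 : (q : ℝ) + 1 ≤ p := by
        have : q < p := by exact_mod_cast h3
        exact_mod_cast this
      have h5 : a < p * a - q * f := by
        nlinarith [mul_nonneg (sub_nonneg.2 h4) ha.le, mul_pos (sub_pos.2 hfa) (zero_lt_one.trans_le hq')]
      exact ⟨h5.le, fun h => absurd h5 (not_lt.2 h)⟩

/-- The columns of either matrix lie in the two cones and in the common lattice, so minimality
applies both ways and its equality case identifies them. -/
theorem reducedDomain_injOn {g h : SL(2, ℝ)} (hg : g ∈ reducedDomain) (hh : h ∈ reducedDomain)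
    (hgh : g⁻¹ * h ∈ sl2Int) : g = h := by
  have key : ∀ g h : SL(2, ℝ), g ∈ reducedDomain → h ∈ reducedDomain → g⁻¹ * h ∈ sl2Int →
      (g 0 0 ≤ h 0 0 ∧ (h 0 0 ≤ g 0 0 → h 0 0 = g 0 0 ∧ h 1 0 = g 1 0)) ∧
      (g 1 1 ≤ h 1 1 ∧ (h 1 1 ≤ g 1 1 → h 0 1 = g 0 1 ∧ h 1 1 = g 1 1)) := by
    rintro g h ⟨⟨g1, g2⟩, ⟨g3, g4⟩, g5, g6⟩ ⟨⟨h1, h2⟩, ⟨h3, h4⟩, h5, h6⟩ hγ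
    obtain ⟨γ, rfl⟩ : ∃ γ, h = g * γ := ⟨g⁻¹ * h, by simp⟩
    rw [inv_mul_cancel_left] at hγ
    obtain ⟨p, hp⟩ := (mem_sl2Int_iff γ).1 hγ 0 0
    obtain ⟨q, hq⟩ := (mem_sl2Int_iff γ).1 hγ 1 0
    obtain ⟨r, hr⟩ := (mem_sl2Int_iff γ).1 hγ 0 1
    obtain ⟨s, hs⟩ := (mem_sl2Int_iff γ).1 hγ 1 1
    simp only [Matrix.SpecialLinearGroup.coe_mul, Matrix.mul_apply, Fin.sum_univ_two, hp, hq,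
      hr, hs] at h1 h2 h3 h4 h5 h6 ⊢
    obtain ⟨m1, m2⟩ := reduced_min g1 g2 g3 g4 g5 g6 (p := p) (q := q) (by linarith) (by linarith)
    obtain ⟨n1, n2⟩ := reduced_min g2 g1 g6 g5 g4 g3 (p := s) (q := r) (by linarith) (by linarith)
    refine ⟨⟨by linarith, fun h => ?_⟩, ⟨by linarith, fun h => ?_⟩⟩
    · obtain ⟨rfl, rfl⟩ := m2 (by linarith)
      simp
    · obtain ⟨rfl, rfl⟩ := n2 (by linarith)
      simp
  obtain ⟨⟨a1, a2⟩, a3, a4⟩ := key g h hg hh hgh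
  have hhg : h⁻¹ * g ∈ sl2Int := by
    have := inv_mem hgh
    rwa [mul_inv_rev, inv_inv] at this
  obtain ⟨⟨b1, b2⟩, b3, b4⟩ := key h g hh hg hhg
  ext i j
  fin_cases i <;> fin_cases j
  exacts [(a2 b1).1.symm, (a4 b3).1.symm, (a2 b1).2.symm, (a4 b3).2.symm]

/-! ### Existence of a reduced basis for generic lattices -/

theorem exists_lattice_point_near (g : SL(2, ℝ)) : ∃ M : ℝ, 0 < M ∧ ∀ x y : ℝ, ∃ p q : ℤ,
    |g 0 0 * p + g 0 1 * q - x| ≤ M ∧ |g 1 0 * p + g 1 1 * q - y| ≤ M := by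
  refine ⟨|g 0 0| + |g 0 1| + |g 1 0| + |g 1 1| + 1, by positivity, fun x y => ?_⟩
  refine ⟨⌊g 1 1 * x - g 0 1 * y⌋, ⌊-g 1 0 * x + g 0 0 * y⌋, ?_⟩
  set u := g 1 1 * x - g 0 1 * y
  set v := -g 1 0 * x + g 0 0 * y
  have hd := sl2_det g
  have hx : x = g 0 0 * u + g 0 1 * v := by
    simp only [u, v]; linear_combination (-x) * hd
  have hy : y = g 1 0 * u + g 1 1 * v := by
    simp only [u, v]; linear_combination (-y) * hd
  have hb : ∀ c d : ℝ, |c * ⌊u⌋ + d * ⌊v⌋ - (c * u + d * v)| ≤ |c| + |d| := by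
    intro c d
    have h1 : c * ⌊u⌋ + d * ⌊v⌋ - (c * u + d * v) = -(c * Int.fract u) - d * Int.fract v := by
      rw [Int.fract, Int.fract]; ring
    have h2 : |c * Int.fract u| ≤ |c| := by
      rw [abs_mul, Int.abs_fract]
      exact mul_le_of_le_one_right (abs_nonneg c) (Int.fract_lt_one u).le
    have h3 : |d * Int.fract v| ≤ |d| := by
      rw [abs_mul, Int.abs_fract]
      exact mul_le_of_le_one_right (abs_nonneg d) (Int.fract_lt_one v).le
    rw [h1]
    calc |-(c * Int.fract u) - d * Int.fract v|
        ≤ |-(c * Int.fract u)| + |d * Int.fract v| := abs_sub _ _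
      _ ≤ |c| + |d| := by rw [abs_neg]; exact add_le_add h2 h3
  constructor
  · have := hb (g 0 0) (g 0 1)
    rw [← hx] at this
    linarith [abs_nonneg (g 1 0), abs_nonneg (g 1 1)]
  · have := hb (g 1 0) (g 1 1)
    rw [← hy] at this
    linarith [abs_nonneg (g 0 0), abs_nonneg (g 0 1)]

theorem finite_lattice_points (g : SL(2, ℝ)) (K : ℝ) :
    {z : ℤ × ℤ | |g 0 0 * z.1 + g 0 1 * z.2| ≤ K ∧ |g 1 0 * z.1 + g 1 1 * z.2| ≤ K}.Finite := by
  obtain ⟨N, hN⟩ := exists_nat_ge ((|g 0 0| + |g 0 1| + |g 1 0| + |g 1 1|) * K)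
  refine (Set.finite_Icc ((-N, -N) : ℤ × ℤ) (N, N)).subset ?_
  rintro ⟨p, q⟩ ⟨h1, h2⟩
  have hd := sl2_det g
  simp only at h1 h2
  have hp : (p : ℝ) = g 1 1 * (g 0 0 * p + g 0 1 * q) - g 0 1 * (g 1 0 * p + g 1 1 * q) := by
    linear_combination (-(p : ℝ)) * hd
  have hq : (q : ℝ) = g 0 0 * (g 1 0 * p + g 1 1 * q) - g 1 0 * (g 0 0 * p + g 0 1 * q) := by
    linear_combination (-(q : ℝ)) * hd
  have hK : 0 ≤ K := (abs_nonneg _).trans h1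
  have hbound : ∀ c d x y : ℝ, |x| ≤ K → |y| ≤ K → |c * x - d * y| ≤ (|c| + |d|) * K := by
    intro c d x y hx hy
    calc |c * x - d * y| ≤ |c * x| + |d * y| := abs_sub _ _
      _ = |c| * |x| + |d| * |y| := by rw [abs_mul, abs_mul]
      _ ≤ |c| * K + |d| * K := by gcongr
      _ = (|c| + |d|) * K := by ring
  have hp' := hbound (g 1 1) (g 0 1) _ _ h1 h2
  have hq' := hbound (g 0 0) (g 1 0) _ _ h2 h1
  rw [← hp] at hp'
  rw [← hq] at hq'
  have e1 : |(p : ℝ)| ≤ N := by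
    nlinarith [mul_nonneg (abs_nonneg (g 0 0)) hK, mul_nonneg (abs_nonneg (g 1 0)) hK]
  have e2 : |(q : ℝ)| ≤ N := by
    nlinarith [mul_nonneg (abs_nonneg (g 0 1)) hK, mul_nonneg (abs_nonneg (g 1 1)) hK]
  rw [abs_le] at e1 e2
  refine ⟨⟨?_, ?_⟩, ⟨?_, ?_⟩⟩ <;> simp only
  · exact_mod_cast e1.1
  · exact_mod_cast e2.1
  · exact_mod_cast e1.2
  · exact_mod_cast e2.2

theorem exists_min_of_finite_sublevel {ι : Type*} {S : Set ι} (hS : S.Nonempty) {F : ι → ℝ}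
    (h : ∀ K, {z | z ∈ S ∧ F z ≤ K}.Finite) : ∃ z ∈ S, ∀ z' ∈ S, F z ≤ F z' := by
  obtain ⟨z₀, h₀⟩ := hS
  obtain ⟨z, hz, hmin⟩ := Set.exists_min_image _ F (h (F z₀)) ⟨z₀, h₀, le_rfl⟩
  refine ⟨z, hz.1, fun z' hz' => ?_⟩
  rcases le_total (F z') (F z₀) with h1 | h1
  · exact hmin z' ⟨hz', h1⟩
  · exact hz.2.trans h1

/-- The two cone minima $u,v$ generate $\Lambda$ because their half-open parallelogram contains no
other lattice point: for such a point $w\neq0$, one of $w$, $u+v-w$, $\pm(w-u)$ would beat a minimum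
or lie on an excluded line. -/
theorem eq_zero_of_mem_fundamental_parallelogram (Λ : AddSubgroup (ℝ × ℝ)) {a b e f : ℝ}
    (he : 0 < e) (hf : 0 < f) (hea : e < a) (hfb : f < b)
    (h1 : (a, -e) ∈ Λ) (h2 : (-f, b) ∈ Λ)
    (m1 : ∀ x y, (x, y) ∈ Λ → y < 0 → 0 < x + y → a ≤ x)
    (m2 : ∀ x y, (x, y) ∈ Λ → x < 0 → 0 < x + y → b ≤ y)
    (hgen : ∀ x y, (x, y) ∈ Λ → x = 0 ∨ y = 0 ∨ x + y = 0 → x = 0 ∧ y = 0)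
    {s t : ℝ} (hs : 0 ≤ s) (hs1 : s < 1) (ht : 0 ≤ t) (ht1 : t < 1)
    (hw : (s * a - t * f, t * b - s * e) ∈ Λ) : s = 0 ∧ t = 0 := by
  have hab : 0 < a * b - e * f := by
    nlinarith [mul_pos (sub_pos.2 hea) hf, mul_pos (he.trans hea) (sub_pos.2 hfb)]
  -- A lattice point of the parallelogram with $x<a$, $y<b$ has positive coordinate sum, so outside
  -- the open first quadrant it would be in one of the cones below its minimum. This is used for $w$
  -- and for $u+v-w$.
  have quadrant : ∀ s t : ℝ, 0 ≤ s → s ≤ 1 → 0 ≤ t → t ≤ 1 → (0 < s ∨ 0 < t) →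
      (s * a - t * f < a) → (t * b - s * e < b) → (s * a - t * f, t * b - s * e) ∈ Λ →
      0 < s * a - t * f ∧ 0 < t * b - s * e := by
    intro s t hs hs1 ht ht1 hst hxa hyb hw
    have hsum : 0 < (s * a - t * f) + (t * b - s * e) := by
      rcases hst with h | h
      · nlinarith [mul_pos h (sub_pos.2 hea), mul_nonneg ht (sub_pos.2 hfb).le]
      · nlinarith [mul_nonneg hs (sub_pos.2 hea).le, mul_pos h (sub_pos.2 hfb)]
    have hx : s * a - t * f ≠ 0 := fun h => by
      have := hgen _ _ hw (Or.inl h); linarith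
    have hy : t * b - s * e ≠ 0 := fun h => by
      have := hgen _ _ hw (Or.inr (Or.inl h)); linarith
    constructor
    · by_contra h
      have := m2 _ _ hw (lt_of_le_of_ne (not_lt.1 h) hx) hsum
      linarith
    · by_contra h
      have := m1 _ _ hw (lt_of_le_of_ne (not_lt.1 h) hy) hsum
      linarith
  by_contra hst
  have hst' : 0 < s ∨ 0 < t := by
    by_contra h
    push Not at h
    exact hst ⟨le_antisymm h.1 hs, le_antisymm h.2 ht⟩
  have ha := he.trans hea
  have hb := hf.trans hfb
  obtain ⟨hx, hy⟩ := quadrant s t hs hs1.le ht ht1.le hst'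
    (by nlinarith [mul_nonneg ht hf.le]) (by nlinarith [mul_nonneg hs he.le]) hw
  have hw' : ((1 - s) * a - (1 - t) * f, (1 - t) * b - (1 - s) * e) ∈ Λ := by
    have := Λ.sub_mem (Λ.add_mem h1 h2) hw
    convert this using 1
    simp only [Prod.mk_add_mk, Prod.mk_sub_mk, Prod.mk.injEq]
    constructor <;> ring
  obtain ⟨hx', hy'⟩ := quadrant (1 - s) (1 - t) (by linarith) (by linarith) (by linarith)
    (by linarith) (Or.inl (by linarith))
    (by nlinarith [mul_nonneg hs ha.le, mul_pos (sub_pos.2 ht1) hf])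
    (by nlinarith [mul_nonneg ht hb.le, mul_pos (sub_pos.2 hs1) he]) hw'
  have hd : (s * a - t * f - a, t * b - s * e - -e) ∈ Λ := Λ.sub_mem hw h1
  have hd' : (a - (s * a - t * f), -e - (t * b - s * e)) ∈ Λ := Λ.sub_mem h1 hw
  have hneg : s * a - t * f - a < 0 := by
    nlinarith [mul_nonneg ht hf.le]
  -- Depending on the sign of its coordinate sum, $w-u$ lies in the second cone with second
  -- coordinate below $b$, or $u-w$ lies in the first cone with first coordinate below $a$, or
  -- genericity fails.
  rcases lt_trichotomy ((s * a - t * f - a) + (t * b - s * e - -e)) 0 with h | h | h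
  · have := m1 _ _ hd' (by linarith) (by linarith)
    linarith
  · have := hgen _ _ hd (Or.inr (Or.inr h))
    linarith
  · have := m2 _ _ hd hneg h
    linarith

/-- The lattice `g ℤ²` as an additive subgroup of `ℝ × ℝ`. -/
def orbitAddSubgroup (g : SL(2, ℝ)) : AddSubgroup (ℝ × ℝ) where
  carrier := {v | ∃ p q : ℤ, v = (g 0 0 * p + g 0 1 * q, g 1 0 * p + g 1 1 * q)}
  zero_mem' := ⟨0, 0, by simp [Prod.zero_eq_mk]⟩
  add_mem' := by
    rintro _ _ ⟨p, q, rfl⟩ ⟨p', q', rfl⟩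
    refine ⟨p + p', q + q', ?_⟩
    ext <;> push_cast <;> simp <;> ring
  neg_mem' := by
    rintro _ ⟨p, q, rfl⟩
    refine ⟨-p, -q, ?_⟩
    ext <;> push_cast <;> simp <;> ring

/-- Matrices `g` such that no nonzero vector of `g ℤ²` lies on one of the lines
`x = 0`, `y = 0`, `x + y = 0`. -/
def genericSet : Set SL(2, ℝ) :=
  {g | ∀ x y, (x, y) ∈ orbitAddSubgroup g → x = 0 ∨ y = 0 ∨ x + y = 0 → x = 0 ∧ y = 0}

/-- In this cone $|y|<x$, so a bound on $x$ leaves finitely many lattice points. -/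
theorem exists_min_first_cone (g : SL(2, ℝ)) : ∃ x y, (x, y) ∈ orbitAddSubgroup g ∧ y < 0 ∧
    0 < x + y ∧ ∀ x' y', (x', y') ∈ orbitAddSubgroup g → y' < 0 → 0 < x' + y' → x ≤ x' := by
  obtain ⟨M, hM, h⟩ := exists_lattice_point_near g
  obtain ⟨z, ⟨hz1, hz2⟩, hmin⟩ := exists_min_of_finite_sublevel
    (S := {z : ℤ × ℤ | g 1 0 * z.1 + g 1 1 * z.2 < 0 ∧
      0 < (g 0 0 * z.1 + g 0 1 * z.2) + (g 1 0 * z.1 + g 1 1 * z.2)})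
    (F := fun z => g 0 0 * z.1 + g 0 1 * z.2) (by
      -- Every point within $M$ of $(5M,-2M)$ in each coordinate is in the cone.
      obtain ⟨p, q, h1, h2⟩ := h (5 * M) (-2 * M)
      rw [abs_le] at h1 h2
      exact ⟨(p, q), by show _ < (0 : ℝ); linarith, by show (0 : ℝ) < _; linarith⟩) (by
      intro K
      refine (finite_lattice_points g K).subset ?_
      rintro z ⟨⟨h1, h2⟩, h3⟩
      constructor <;> rw [abs_le] <;> constructor <;> linarith)
  refine ⟨_, _, ⟨z.1, z.2, rfl⟩, hz1, hz2, ?_⟩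
  rintro x' y' ⟨p, q, h⟩ hy hxy
  obtain ⟨rfl, rfl⟩ := Prod.mk.inj h
  exact hmin (p, q) ⟨hy, hxy⟩

theorem exists_min_second_cone (g : SL(2, ℝ)) : ∃ x y, (x, y) ∈ orbitAddSubgroup g ∧ x < 0 ∧
    0 < x + y ∧ ∀ x' y', (x', y') ∈ orbitAddSubgroup g → x' < 0 → 0 < x' + y' → y ≤ y' := by
  obtain ⟨M, hM, h⟩ := exists_lattice_point_near g
  obtain ⟨z, ⟨hz1, hz2⟩, hmin⟩ := exists_min_of_finite_sublevel
    (S := {z : ℤ × ℤ | g 0 0 * z.1 + g 0 1 * z.2 < 0 ∧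
      0 < (g 0 0 * z.1 + g 0 1 * z.2) + (g 1 0 * z.1 + g 1 1 * z.2)})
    (F := fun z => g 1 0 * z.1 + g 1 1 * z.2) (by
      obtain ⟨p, q, h1, h2⟩ := h (-2 * M) (5 * M)
      rw [abs_le] at h1 h2
      exact ⟨(p, q), by show _ < (0 : ℝ); linarith, by show (0 : ℝ) < _; linarith⟩) (by
      intro K
      refine (finite_lattice_points g K).subset ?_
      rintro z ⟨⟨h1, h2⟩, h3⟩
      constructor <;> rw [abs_le] <;> constructor <;> linarith)
  refine ⟨_, _, ⟨z.1, z.2, rfl⟩, hz1, hz2, ?_⟩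
  rintro x' y' ⟨p, q, h⟩ hy hxy
  obtain ⟨rfl, rfl⟩ := Prod.mk.inj h
  exact hmin (p, q) ⟨hy, hxy⟩

theorem exists_mul_mem_reducedDomain {g : SL(2, ℝ)} (hg : g ∈ genericSet) :
    ∃ γ ∈ sl2Int, g * γ ∈ reducedDomain := by
  obtain ⟨a, e', h1, he', hae, m1⟩ := exists_min_first_cone g
  obtain ⟨f', b, h2, hf', hbf, m2⟩ := exists_min_second_cone g
  obtain ⟨e, rfl⟩ : ∃ e, e' = -e := ⟨-e', by simp⟩
  obtain ⟨f, rfl⟩ : ∃ f, f' = -f := ⟨-f', by simp⟩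
  have he : 0 < e := by linarith
  have hf : 0 < f := by linarith
  have hea : e < a := by linarith
  have hfb : f < b := by linarith
  have h12 : (a + -f, -e + b) ∈ orbitAddSubgroup g := AddSubgroup.add_mem _ h1 h2
  -- Otherwise $u+v$ falls in the second cone with second coordinate $b-e<b$, or on the line $x=0$.
  -- The inequality $e<b$ is symmetric.
  have hfa : f < a := by
    by_contra hc
    rcases eq_or_lt_of_le (not_lt.1 hc) with h | h
    · have := hg _ _ h12 (Or.inl (by linarith))
      linarith
    · have := m2 _ _ h12 (by linarith) (by linarith)
      linarith
  have heb : e < b := by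
    by_contra hc
    rcases eq_or_lt_of_le (not_lt.1 hc) with h | h
    · have := hg _ _ h12 (Or.inr (Or.inl (by linarith)))
      linarith
    · have := m1 _ _ h12 (by linarith) (by linarith)
      linarith
  have hD : 0 < a * b - e * f := by
    nlinarith [mul_pos (sub_pos.2 hea) hf, mul_pos (he.trans hea) (sub_pos.2 hfb)]
  -- Solve for real coefficients in the basis $u,v$ and subtract integer parts; the remainder is a
  -- lattice point of the parallelogram, hence zero.
  have hcoef : ∀ x y, (x, y) ∈ orbitAddSubgroup g →
      ∃ S T : ℤ, x = S * a - T * f ∧ y = T * b - S * e := by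
    intro x y hxy
    set s := (b * x + f * y) / (a * b - e * f) with hs
    set t := (e * x + a * y) / (a * b - e * f) with ht
    have hD' := hD.ne'
    have hx : x = s * a - t * f := by
      rw [hs, ht, div_mul_eq_mul_div, div_mul_eq_mul_div, ← sub_div, eq_div_iff hD']; ring
    have hy : y = t * b - s * e := by
      rw [hs, ht, div_mul_eq_mul_div, div_mul_eq_mul_div, ← sub_div, eq_div_iff hD']; ring
    have hmem : (Int.fract s * a - Int.fract t * f, Int.fract t * b - Int.fract s * e) ∈
        orbitAddSubgroup g := by
      have := AddSubgroup.sub_mem _ (AddSubgroup.sub_mem _ hxy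
        (AddSubgroup.zsmul_mem _ h1 ⌊s⌋)) (AddSubgroup.zsmul_mem _ h2 ⌊t⌋)
      convert this using 1
      simp only [Int.fract, Prod.smul_mk, zsmul_eq_mul, Prod.mk_sub_mk, Prod.mk.injEq]
      constructor
      · linear_combination -hx
      · linear_combination -hy
    obtain ⟨hs0, ht0⟩ := eq_zero_of_mem_fundamental_parallelogram _ he hf hea hfb h1 h2
      m1 m2 hg (Int.fract_nonneg s) (Int.fract_lt_one s) (Int.fract_nonneg t)
      (Int.fract_lt_one t) hmem
    refine ⟨⌊s⌋, ⌊t⌋, ?_, ?_⟩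
    · rw [← sub_eq_zero.1 hs0, ← sub_eq_zero.1 ht0]; exact hx
    · rw [← sub_eq_zero.1 hs0, ← sub_eq_zero.1 ht0]; exact hy
  obtain ⟨S₁, T₁, i1, i2⟩ := hcoef (g 0 0) (g 1 0) ⟨1, 0, by simp⟩
  obtain ⟨S₂, T₂, i3, i4⟩ := hcoef (g 0 1) (g 1 1) ⟨0, 1, by simp⟩
  have hd := sl2_det g
  obtain ⟨p₁, q₁, hpq₁⟩ := h1
  obtain ⟨p₂, q₂, hpq₂⟩ := h2
  obtain ⟨j1, j2⟩ := Prod.mk.inj hpq₁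
  obtain ⟨j3, j4⟩ := Prod.mk.inj hpq₂
  have hDint : a * b - e * f = ((p₁ * q₂ - p₂ * q₁ : ℤ) : ℝ) := by
    push_cast
    have h0 : a * b - e * f = a * b - (-e) * (-f) := by ring
    rw [h0, j1, j2, j3, j4]
    linear_combination ((p₁ : ℝ) * q₂ - p₂ * q₁) * hd
  -- The two integer base changes have determinants with product $1$, and $ab-ef>0$ selects the
  -- sign, giving $ab-ef=1$.
  have hprod : (p₁ * q₂ - p₂ * q₁) * (S₁ * T₂ - S₂ * T₁) = 1 := by
    have : ((p₁ * q₂ - p₂ * q₁ : ℤ) : ℝ) * ((S₁ * T₂ - S₂ * T₁ : ℤ) : ℝ) = 1 := by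
      rw [← hDint]
      push_cast
      rw [i1, i2, i3, i4] at hd
      linear_combination hd
    exact_mod_cast this
  have hpos : 0 < p₁ * q₂ - p₂ * q₁ := by
    rw [hDint] at hD
    exact_mod_cast hD
  have hone : p₁ * q₂ - p₂ * q₁ = 1 := Int.eq_one_of_mul_eq_one_right hpos.le hprod
  rw [hone, Int.cast_one] at hDint
  obtain ⟨h, hh⟩ : ∃ h : SL(2, ℝ), (h : Matrix (Fin 2) (Fin 2) ℝ) = !![a, -f; -e, b] :=
    ⟨⟨!![a, -f; -e, b], by rw [Matrix.det_fin_two_of]; linarith⟩, rfl⟩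
  have hN : h⁻¹ * g ∈ sl2Int := by
    rw [mem_sl2Int_iff]
    have hcoe : ((h⁻¹ * g : SL(2, ℝ)) : Matrix (Fin 2) (Fin 2) ℝ) = !![(S₁ : ℝ), S₂; T₁, T₂] := by
      ext i j
      fin_cases i <;> fin_cases j <;>
        simp [Matrix.mul_apply, Fin.sum_univ_two, hh, Matrix.SpecialLinearGroup.coe_inv,
          Matrix.adjugate_fin_two, i1, i2, i3, i4]
      · linear_combination (S₁ : ℝ) * hDint
      · linear_combination (S₂ : ℝ) * hDint
      · linear_combination (T₁ : ℝ) * hDint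
      · linear_combination (T₂ : ℝ) * hDint
    intro i j
    rw [hcoe]
    fin_cases i <;> fin_cases j
    exacts [⟨S₁, rfl⟩, ⟨S₂, rfl⟩, ⟨T₁, rfl⟩, ⟨T₂, rfl⟩]
  refine ⟨g⁻¹ * h, by simpa using inv_mem hN, ?_⟩
  rw [mul_inv_cancel_left]
  refine ⟨⟨?_, ?_⟩, ⟨?_, ?_⟩, ?_, ?_⟩ <;> simp [hh] <;> assumption

/-! ### The covering radius of the triangle -/

theorem mem_smul_cornerSimplex_iff {r : ℝ} (hr : 0 < r) (x : Fin 2 → ℝ) :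
    x ∈ r • cornerSimplex 2 ↔ 0 ≤ x 0 ∧ 0 ≤ x 1 ∧ x 0 + x 1 ≤ r := by
  rw [Set.mem_smul_set_iff_inv_smul_mem₀ hr.ne']
  have h : r⁻¹ * x 0 + r⁻¹ * x 1 = (x 0 + x 1) / r := by field_simp
  simp only [cornerSimplex, Set.mem_ofPred_eq, Fin.forall_fin_two, Fin.sum_univ_two, Pi.smul_apply,
    smul_eq_mul, h, div_le_one hr, mul_nonneg_iff_of_pos_left (inv_pos.2 hr), and_assoc]

namespace UnimodularLattice

/-- Translates of the quadrant $\{y\ge0\}$ by lattice points cover the plane; cutting each at the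
lattice point of largest coordinate sum leaves the L-shaped tile $[0,a)\times[0,b)$ minus the points
$\ge(a-f,b-e)$. The radius is the largest coordinate sum at its outer corners $(a,b-e)$ and
$(a-f,b)$. -/
theorem coveringRadius_smul_std {g : SL(2, ℝ)} (hg : g ∈ reducedDomain) :
    coveringRadius (cornerSimplex 2) (g • std 2).lattice =
      g 0 0 + g 1 1 - min (-g 1 0) (-g 0 1) := by
  obtain ⟨⟨he, hf⟩, ⟨hea, heb⟩, hfa, hfb⟩ := hg
  obtain ⟨a, ha⟩ : ∃ a, g 0 0 = a := ⟨_, rfl⟩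
  obtain ⟨b, hb⟩ : ∃ b, g 1 1 = b := ⟨_, rfl⟩
  obtain ⟨e, he'⟩ : ∃ e, g 1 0 = -e := ⟨-g 1 0, by simp⟩
  obtain ⟨f, hf'⟩ : ∃ f, g 0 1 = -f := ⟨-g 0 1, by simp⟩
  have hmem := mem_smul_std_iff g
  have hfin := finite_lattice_points g
  have hnear := exists_lattice_point_near g
  simp only [ha, hb, he', hf', neg_neg] at he hf hea heb hfa hfb hmem hfin hnear ⊢
  have hrad : a + b - min e f = max (a + (b - e)) ((a - f) + b) := by
    rcases le_total e f with h | h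
    · rw [min_eq_left h, max_eq_left (by linarith)]; ring
    · rw [min_eq_right h, max_eq_right (by linarith)]; ring
  rw [hrad]
  set ρ := max (a + (b - e)) ((a - f) + b) with hρ
  have hρ0 : 0 < ρ := lt_max_of_lt_left (by linarith)
  have hcover : ρ ∈ {r : ℝ | 0 < r ∧
      r • cornerSimplex 2 + ((g • std 2).lattice : Set (Fin 2 → ℝ)) = Set.univ} := by
    refine ⟨hρ0, Set.eq_univ_iff_forall.2 fun x => ?_⟩
    obtain ⟨M, hM, hnear⟩ := hnear
    obtain ⟨⟨p, q⟩, ⟨hz1, hz2⟩, hmin⟩ := exists_min_of_finite_sublevel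
      (S := {z : ℤ × ℤ | a * z.1 + -f * z.2 ≤ x 0 ∧ -e * z.1 + b * z.2 ≤ x 1})
      (F := fun z => x 0 - (a * z.1 + -f * z.2) + (x 1 - (-e * z.1 + b * z.2))) (by
        obtain ⟨p, q, h1, h2⟩ := hnear (x 0 - M) (x 1 - M)
        rw [abs_le] at h1 h2
        exact ⟨(p, q), by show _ ≤ x 0; linarith, by show _ ≤ x 1; linarith⟩) (by
        intro K
        refine (hfin (|x 0| + |x 1| + |K|)).subset ?_
        rintro z ⟨⟨h1, h2⟩, h3⟩
        have := le_abs_self (x 0)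
        have := le_abs_self (x 1)
        have := neg_abs_le (x 0)
        have := neg_abs_le (x 1)
        have := le_abs_self K
        have := abs_nonneg K
        constructor <;> rw [abs_le] <;> constructor <;> linarith)
    simp only at hz1 hz2
    -- By minimality, the remainder of $x$ cannot dominate a lattice vector of positive coordinate
    -- sum. Testing $u$, $v$ and $u+v$ confines it to the L-shaped tile.
    have hred : ∀ m n : ℤ, 0 < m * (a - e) + n * (b - f) →
        x 0 - (a * p + -f * q) < m * a - n * f ∨ x 1 - (-e * p + b * q) < n * b - m * e := by
      intro m n hmn
      by_contra hc
      push Not at hc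
      have := hmin (p + m, q + n) ⟨by push_cast; linarith [hc.1], by push_cast; linarith [hc.2]⟩
      push_cast at this
      linarith
    have h10 := hred 1 0 (by push_cast; linarith)
    have h01 := hred 0 1 (by push_cast; linarith)
    have h11 := hred 1 1 (by push_cast; linarith)
    push_cast at h10 h01 h11
    have hx0 : x 0 - (a * p + -f * q) < a := by
      rcases h10 with h | h <;> linarith
    have hx1 : x 1 - (-e * p + b * q) < b := by
      rcases h01 with h | h <;> linarith
    refine Set.mem_add.2 ⟨x - ![a * p + -f * q, -e * p + b * q], ?_,
      ![a * p + -f * q, -e * p + b * q], (hmem _).2 ⟨p, q, by simp, by simp⟩, sub_add_cancel _ _⟩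
    rw [mem_smul_cornerSimplex_iff hρ0]
    simp only [Pi.sub_apply, Matrix.cons_val_zero, Matrix.cons_val_one]
    refine ⟨by linarith, by linarith, ?_⟩
    rcases h11 with h | h
    · exact le_trans (by linarith) (le_max_right _ _)
    · exact le_trans (by linarith) (le_max_left _ _)
  refine le_antisymm (csInf_le ⟨0, fun r hr => hr.1.le⟩ hcover) (le_csInf ⟨ρ, hcover⟩ ?_)
  rintro r ⟨hr, hcov⟩
  -- If every lattice point below $z$ has coordinate sum at most $0$, then the triangle covering $z$
  -- has size at least $z_0+z_1$.
  have hcorner : ∀ z : Fin 2 → ℝ, (∀ p q : ℤ, a * p + -f * q ≤ z 0 → -e * p + b * q ≤ z 1 →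
      (a - e) * p + (b - f) * q ≤ 0) → z 0 + z 1 ≤ r := by
    intro z hz
    obtain ⟨y, hy, l, hl, hyl⟩ := Set.mem_add.1 (hcov.symm ▸ Set.mem_univ z)
    rw [mem_smul_cornerSimplex_iff hr] at hy
    obtain ⟨p, q, hp, hq⟩ := (hmem l).1 hl
    have h0 : y 0 + l 0 = z 0 := congrFun hyl 0
    have h1 : y 1 + l 1 = z 1 := congrFun hyl 1
    have := hz p q (by linarith) (by linarith)
    linarith
  have hcases : ∀ a b e f : ℝ, 0 < e → 0 < f → e < a → e < b → f < a → f < b → ∀ p q : ℤ,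
      a * p - f * q < a → b * q - e * p < b - e → (a - e) * p + (b - f) * q ≤ 0 := by
    intro a b e f he hf hea heb hfa hfb p q h1 h2
    by_contra hc
    push Not at hc
    rcases le_or_gt p 0 with hp | hp
    · have hp' : (p : ℝ) ≤ 0 := by exact_mod_cast hp
      rcases le_or_gt q 0 with hq | hq
      · have hq' : (q : ℝ) ≤ 0 := by exact_mod_cast hq
        linarith [mul_nonneg (sub_pos.2 hea).le (neg_nonneg.2 hp'),
          mul_nonneg (sub_pos.2 hfb).le (neg_nonneg.2 hq')]
      · have hq' : (1 : ℝ) ≤ q := by exact_mod_cast hq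
        linarith [mul_nonneg he.le (neg_nonneg.2 hp'),
          mul_nonneg (he.trans heb).le (sub_nonneg.2 hq')]
    · have hp' : (1 : ℝ) ≤ p := by exact_mod_cast hp
      have hpq : p ≤ q := by
        by_contra h
        have h3 : q ≤ p - 1 := by omega
        have h4 : (q : ℝ) ≤ p - 1 := by exact_mod_cast h3
        linarith [mul_nonneg hf.le (sub_nonneg.2 h4), mul_nonneg (sub_pos.2 hfa).le
          (sub_nonneg.2 hp')]
      have hpq' : (p : ℝ) ≤ q := by exact_mod_cast hpq
      linarith [mul_nonneg (he.trans heb).le (sub_nonneg.2 hpq'),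
        mul_nonneg (sub_pos.2 heb).le (sub_nonneg.2 hp')]
  refine max_le (le_of_forall_pos_sub_le fun ε hε => ?_) (le_of_forall_pos_sub_le fun ε hε => ?_)
  · have := hcorner ![a - ε / 2, b - e - ε / 2] fun p q h1 h2 => by
      simp only [Matrix.cons_val_zero, Matrix.cons_val_one] at h1 h2
      exact hcases a b e f he hf hea heb hfa hfb p q (by linarith) (by linarith)
    simp only [Matrix.cons_val_zero, Matrix.cons_val_one] at this
    linarith
  · have := hcorner ![a - f - ε / 2, b - ε / 2] fun p q h1 h2 => by
      simp only [Matrix.cons_val_zero, Matrix.cons_val_one] at h1 h2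
      -- The second corner is the first one after exchanging the coordinates and the basis vectors.
      have := hcases b a f e hf he hfb hfa heb hea q p (by linarith) (by linarith)
      linarith
    simp only [Matrix.cons_val_zero, Matrix.cons_val_one] at this
    linarith

end UnimodularLattice

/-! ### Invariant measures on the space of lattices -/

theorem sl2Haar_first_entry_null {p q : ℤ} (h : ¬(p = 0 ∧ q = 0)) :
    sl2Haar {g | g 0 0 * p + g 0 1 * q = 0} = 0 := by
  have hcont : Continuous fun g : SL(2, ℝ) => g 0 0 * p + g 0 1 * q := by fun_prop
  have hm : MeasurableSet {g : SL(2, ℝ) | g 0 0 * p + g 0 1 * q = 0} :=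
    (isClosed_singleton.preimage hcont).measurableSet
  rw [← lintegral_indicator_one hm, lintegral_sl2Haar (measurable_one.indicator hm),
    ← lintegral_zero (α := ℝ) (μ := volume)]
  have hne : ∀ᵐ a : ℝ, a ≠ 0 := by simp [ae_iff]
  refine lintegral_congr_ae ?_
  filter_upwards [hne] with a ha
  rw [← lintegral_zero (α := ℝ) (μ := volume)]
  refine lintegral_congr fun e => ?_
  rw [← lintegral_zero (α := ℝ) (μ := volume)]
  refine lintegral_congr_ae ?_
  have hne' : ∀ᵐ f : ℝ, f ≠ a * p / q := by simp [ae_iff]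
  filter_upwards [hne'] with f hf
  rw [Set.indicator_of_notMem, mul_zero]
  intro hmem
  have h1 : a * p + -f * q = 0 := by
    have h0 : (sl2Coord (a, e, f)) 0 0 * p + (sl2Coord (a, e, f)) 0 1 * q = (0 : ℝ) := hmem
    simpa [coe_sl2Coord ha] using h0
  by_cases hq : q = 0
  · have hp : p ≠ 0 := fun hp => h ⟨hp, hq⟩
    simp [hq, ha, hp] at h1
  · have : (q : ℝ) ≠ 0 := by exact_mod_cast hq
    apply hf
    field_simp
    linarith

/-- Left multiplication by the Weyl element and by a shear moves $y$ and $x+y$ into the first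
coordinate, so left invariance reduces everything to countably many null sets attached to the line
$x=0$. -/
theorem sl2Haar_compl_genericSet : sl2Haar genericSetᶜ = 0 := by
  obtain ⟨u, hu⟩ : ∃ u : SL(2, ℝ), (u : Matrix (Fin 2) (Fin 2) ℝ) = !![1, 1; 0, 1] :=
    ⟨⟨!![1, 1; 0, 1], by simp⟩, rfl⟩
  have hsub : (genericSetᶜ : Set SL(2, ℝ)) ⊆ ⋃ z : {z : ℤ × ℤ // ¬(z.1 = 0 ∧ z.2 = 0)},
      ({g : SL(2, ℝ) | g 0 0 * z.1.1 + g 0 1 * z.1.2 = 0} ∪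
        (weylElement * ·) ⁻¹' {g : SL(2, ℝ) | g 0 0 * z.1.1 + g 0 1 * z.1.2 = 0}) ∪
        (u * ·) ⁻¹' {g : SL(2, ℝ) | g 0 0 * z.1.1 + g 0 1 * z.1.2 = 0} := by
    intro g hg
    simp only [genericSet, Set.mem_compl_iff, Set.mem_ofPred_eq, not_forall] at hg
    obtain ⟨x, y, ⟨p, q, hpq⟩, hor, hne⟩ := hg
    obtain ⟨rfl, rfl⟩ := Prod.mk.inj hpq
    have hz : ¬(p = 0 ∧ q = 0) := by
      rintro ⟨rfl, rfl⟩
      simp at hne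
    refine Set.mem_iUnion.2 ⟨⟨(p, q), hz⟩, ?_⟩
    rcases hor with h | h | h
    · exact Or.inl (Or.inl h)
    · refine Or.inl (Or.inr ?_)
      change (weylElement * g) 0 0 * (p : ℝ) + (weylElement * g) 0 1 * (q : ℝ) = 0
      simpa [Matrix.mul_apply, Fin.sum_univ_two] using h
    · refine Or.inr ?_
      change (u * g) 0 0 * (p : ℝ) + (u * g) 0 1 * (q : ℝ) = 0
      simp only [Matrix.SpecialLinearGroup.coe_mul, hu, Matrix.mul_apply, Fin.sum_univ_two]
      simp
      linarith
  refine measure_mono_null hsub (measure_iUnion_null fun z => ?_)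
  have h0 := sl2Haar_first_entry_null z.2
  refine measure_union_null (measure_union_null h0 ?_) ?_
  · rw [measure_preimage_mul]; exact h0
  · rw [measure_preimage_mul]; exact h0

theorem isOpen_reducedDomain : IsOpen reducedDomain := by
  have h : ∀ i j, Continuous fun g : SL(2, ℝ) => g i j := by
    intro i j; fun_prop
  refine ((isOpen_lt continuous_const (h 1 0).neg).inter
    (isOpen_lt continuous_const (h 0 1).neg)).inter (((isOpen_lt (h 1 0).neg (h 0 0)).inter
    (isOpen_lt (h 1 0).neg (h 1 1))).inter ((isOpen_lt (h 0 1).neg (h 0 0)).inter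
    (isOpen_lt (h 0 1).neg (h 1 1))))

theorem isFundamentalDomain_reducedDomain :
    IsFundamentalDomain sl2Int.op reducedDomain sl2Haar where
  nullMeasurableSet := isOpen_reducedDomain.measurableSet.nullMeasurableSet
  ae_covers := by
    have h : ∀ᵐ g ∂sl2Haar, g ∈ genericSet := sl2Haar_compl_genericSet
    filter_upwards [h] with g hg
    obtain ⟨γ, hγ, hgγ⟩ := exists_mul_mem_reducedDomain hg
    exact ⟨⟨MulOpposite.op γ, hγ⟩, hgγ⟩
  aedisjoint := by
    rintro ⟨γ, hγ⟩ ⟨δ, hδ⟩ hne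
    refine Disjoint.aedisjoint (Set.disjoint_left.2 ?_)
    rintro _ ⟨g, hg, rfl⟩ ⟨h, hh, heq⟩
    have heq' : h * δ.unop = g * γ.unop := heq
    have h1 : g⁻¹ * h = γ.unop * δ.unop⁻¹ := by
      rw [eq_mul_inv_iff_mul_eq, mul_assoc, heq', inv_mul_cancel_left]
    have h2 : g = h := by
      refine reducedDomain_injOn hg hh ?_
      rw [h1]
      exact mul_mem hγ (inv_mem hδ)
    subst h2
    apply hne
    have h3 : δ.unop = γ.unop := mul_left_cancel heq'
    exact Subtype.ext (MulOpposite.unop_injective h3.symm)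

namespace UnimodularLattice

/-- The orbit map `g ↦ g ℤ²`. -/
noncomputable def orbitMap (g : SL(2, ℝ)) : UnimodularLattice 2 := g • std 2

theorem orbitMap_mul (g h : SL(2, ℝ)) : orbitMap (g * h) = g • orbitMap h := mul_smul _ _ _

theorem orbitMap_mul_of_mem (g : SL(2, ℝ)) {γ : SL(2, ℝ)} (hγ : γ ∈ sl2Int) :
    orbitMap (g * γ) = orbitMap g := by
  rw [orbitMap_mul, orbitMap, (smul_std_eq_std_iff γ).2 hγ]
  rfl

theorem isOpenQuotientMap_orbitMap : IsOpenQuotientMap orbitMap where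
  surjective := exists_smul_std_eq
  continuous := continuous_coinduced_rng
  isOpenMap := by
    intro U hU
    refine isOpen_coinduced.2 ?_
    have h : (fun g : SL(2, ℝ) => g • std 2) ⁻¹' (orbitMap '' U) =
        ⋃ γ : sl2Int, (fun g => g * (γ : SL(2, ℝ))) ⁻¹' U := by
      ext g
      simp only [Set.mem_preimage, Set.mem_image, Set.mem_iUnion]
      constructor
      · rintro ⟨h, hU, heq⟩
        exact ⟨⟨g⁻¹ * h, (smul_std_eq_smul_std_iff g h).1 heq.symm⟩, by simpa using hU⟩
      · rintro ⟨γ, hγ⟩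
        exact ⟨_, hγ, orbitMap_mul_of_mem g γ.2⟩
    rw [h]
    exact isOpen_iUnion fun γ => hU.preimage (continuous_mul_const _)

theorem continuous_smul_lattice :
    Continuous fun p : SL(2, ℝ) × UnimodularLattice 2 => p.1 • p.2 := by
  rw [← (IsOpenQuotientMap.id.prodMap isOpenQuotientMap_orbitMap).continuous_comp_iff]
  have h : (fun p : SL(2, ℝ) × UnimodularLattice 2 => p.1 • p.2) ∘ Prod.map id orbitMap =
      fun p : SL(2, ℝ) × SL(2, ℝ) => orbitMap (p.1 * p.2) := by
    ext1 p
    exact (orbitMap_mul _ _).symm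
  rw [h]
  exact isOpenQuotientMap_orbitMap.continuous.comp continuous_mul

theorem measurable_const_smul_lattice (g : SL(2, ℝ)) :
    Measurable fun L : UnimodularLattice 2 => g • L :=
  (continuous_smul_lattice.comp (Continuous.prodMk_right g)).measurable

theorem measurable_orbitMap : Measurable orbitMap := isOpenQuotientMap_orbitMap.continuous.measurable

/-- The invariant probability measure on the space of lattices. -/
noncomputable def invariantMeasure : Measure (UnimodularLattice 2) :=
  (sl2Haar reducedDomain)⁻¹ • (sl2Haar.restrict reducedDomain).map orbitMap

theorem invariantMeasure_apply {A : Set (UnimodularLattice 2)} (hA : MeasurableSet A) :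
    invariantMeasure A =
      (sl2Haar reducedDomain)⁻¹ * sl2Haar (orbitMap ⁻¹' A ∩ reducedDomain) := by
  rw [invariantMeasure, Measure.smul_apply, smul_eq_mul, Measure.map_apply measurable_orbitMap hA,
    Measure.restrict_apply (measurable_orbitMap hA)]

theorem isInvariantProbability_invariantMeasure (h0 : sl2Haar reducedDomain ≠ 0)
    (htop : sl2Haar reducedDomain ≠ ⊤) : IsInvariantProbability invariantMeasure := by
  refine ⟨⟨?_⟩, ⟨fun h A hA => ?_⟩⟩
  · rw [invariantMeasure_apply MeasurableSet.univ, Set.preimage_univ, Set.univ_inter,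
      ENNReal.inv_mul_cancel h0 htop]
  · rw [invariantMeasure_apply (measurable_const_smul_lattice h hA), invariantMeasure_apply hA]
    congr 1
    -- Left multiplication commutes with the right action, so $h\cdot$`reducedDomain` is again a
    -- fundamental domain, and right-periodic sets have the same measure in both.
    have h1 : orbitMap ⁻¹' ((fun L => h • L) ⁻¹' A) ∩ reducedDomain =
        (h * ·) ⁻¹' (orbitMap ⁻¹' A ∩ h • reducedDomain) := by
      ext g
      simp only [Set.mem_inter_iff, Set.mem_preimage, orbitMap_mul]
      refine and_congr_right fun _ => ?_
      exact (Set.smul_mem_smul_set_iff (a := h)).symm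
    rw [h1, measure_preimage_mul]
    refine (isFundamentalDomain_reducedDomain.smul_of_comm h).measure_set_eq
      isFundamentalDomain_reducedDomain (measurable_orbitMap hA) ?_
    rintro ⟨γ, hγ⟩
    ext g
    change orbitMap (g * γ.unop) ∈ A ↔ orbitMap g ∈ A
    rw [orbitMap_mul_of_mem g hγ]

theorem orbitMap_mem_image_reducedDomain {g : SL(2, ℝ)} (hg : g ∈ genericSet) :
    orbitMap g ∈ orbitMap '' reducedDomain := by
  obtain ⟨γ, hγ, h⟩ := exists_mul_mem_reducedDomain hg
  exact ⟨_, h, orbitMap_mul_of_mem g hγ⟩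

theorem isOpen_image_reducedDomain : IsOpen (orbitMap '' reducedDomain) :=
  isOpenQuotientMap_orbitMap.isOpenMap _ isOpen_reducedDomain

theorem sl2Haar_preimage_compl :
    sl2Haar (orbitMap ⁻¹' (orbitMap '' reducedDomain)ᶜ) = 0 :=
  measure_mono_null (fun _ hg hgen => hg (orbitMap_mem_image_reducedDomain hgen))
    sl2Haar_compl_genericSet

/-! ### Uniqueness of the invariant probability -/

/-- Measure $\{(g,x): gx\in E\}$ in two ways, $E$ being the complement. Invariance of $\nu$ gives
$\nu(E)$ times the Haar mass of the group; for fixed $x=k\mathbb Z^2$, right invariance gives $0$.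
-/
theorem ae_mem_image_reducedDomain (h0 : sl2Haar reducedDomain ≠ 0)
    {ν : Measure (UnimodularLattice 2)} (hν : IsInvariantProbability ν) :
    ∀ᵐ x ∂ν, x ∈ orbitMap '' reducedDomain := by
  have := hν.1
  have := hν.2
  set E := (orbitMap '' reducedDomain)ᶜ with hE
  have hEm : MeasurableSet E := isOpen_image_reducedDomain.measurableSet.compl
  change ν E = 0
  have hF : MeasurableSet ((fun p : SL(2, ℝ) × UnimodularLattice 2 => p.1 • p.2) ⁻¹' E) :=
    continuous_smul_lattice.measurable hEm
  have h1 := Measure.prod_apply (μ := sl2Haar) (ν := ν) hF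
  have h2 := Measure.prod_apply_symm (μ := sl2Haar) (ν := ν) hF
  have h3 : ∀ x : UnimodularLattice 2, sl2Haar ((fun g => (g, x)) ⁻¹'
      ((fun p : SL(2, ℝ) × UnimodularLattice 2 => p.1 • p.2) ⁻¹' E)) = 0 := by
    intro x
    obtain ⟨k, rfl⟩ := isOpenQuotientMap_orbitMap.surjective x
    have : ((fun g => (g, orbitMap k)) ⁻¹'
        ((fun p : SL(2, ℝ) × UnimodularLattice 2 => p.1 • p.2) ⁻¹' E)) =
        (fun g => g * k) ⁻¹' (orbitMap ⁻¹' E) := by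
      ext g
      simp only [Set.mem_preimage, orbitMap_mul]
    rw [this, measure_preimage_mul_right, sl2Haar_preimage_compl]
  have h4 : ∀ g : SL(2, ℝ), ν (Prod.mk g ⁻¹'
      ((fun p : SL(2, ℝ) × UnimodularLattice 2 => p.1 • p.2) ⁻¹' E)) = ν E := by
    intro g
    exact SMulInvariantMeasure.measure_preimage_smul g hEm
  simp only [h3, lintegral_zero] at h2
  simp only [h4, lintegral_const] at h1
  rw [h1, mul_eq_zero] at h2
  refine h2.resolve_right fun h => h0 (measure_mono_null (Set.subset_univ _) h)

open scoped Classical in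
/-- A section of the orbit map over the image of the reduced domain. -/
noncomputable def reducedSection (x : UnimodularLattice 2) : SL(2, ℝ) :=
  if h : x ∈ orbitMap '' reducedDomain then h.choose else 1

theorem reducedSection_mem {x : UnimodularLattice 2} (h : x ∈ orbitMap '' reducedDomain) :
    reducedSection x ∈ reducedDomain := by
  rw [reducedSection, dif_pos h]
  exact h.choose_spec.1

theorem orbitMap_reducedSection {x : UnimodularLattice 2} (h : x ∈ orbitMap '' reducedDomain) :
    orbitMap (reducedSection x) = x := by
  rw [reducedSection, dif_pos h]
  exact h.choose_spec.2

theorem reducedSection_orbitMap {g : SL(2, ℝ)} (hg : g ∈ reducedDomain) :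
    reducedSection (orbitMap g) = g := by
  have h : orbitMap g ∈ orbitMap '' reducedDomain := ⟨g, hg, rfl⟩
  exact reducedDomain_injOn (reducedSection_mem h) hg
    ((smul_std_eq_smul_std_iff _ _).1 (orbitMap_reducedSection h))

/-- Over the open image the section inverts the injective restriction of an open map, so preimages
of open sets are open there; elsewhere it is constant. -/
theorem measurable_reducedSection : Measurable reducedSection := by
  refine measurable_of_isOpen fun U hU => ?_
  have h : reducedSection ⁻¹' U = orbitMap '' (reducedDomain ∩ U) ∪
      ((orbitMap '' reducedDomain)ᶜ ∩ {_x | (1 : SL(2, ℝ)) ∈ U}) := by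
    ext x
    by_cases hx : x ∈ orbitMap '' reducedDomain
    · simp only [Set.mem_preimage, Set.mem_union, Set.mem_inter_iff, Set.mem_compl_iff, hx,
        not_true_eq_false, false_and, or_false]
      constructor
      · exact fun hU => ⟨_, ⟨reducedSection_mem hx, hU⟩, orbitMap_reducedSection hx⟩
      · rintro ⟨g, ⟨hg, hgU⟩, rfl⟩
        rwa [reducedSection_orbitMap hg]
    · have hx' : x ∉ orbitMap '' (reducedDomain ∩ U) := fun h' =>
        hx (Set.image_mono Set.inter_subset_left h')
      simp only [Set.mem_preimage, Set.mem_union, Set.mem_inter_iff, Set.mem_compl_iff, hx, hx',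
        not_false_eq_true, true_and, false_or, reducedSection, dif_neg]
      rfl
  rw [h]
  refine MeasurableSet.union ?_ (isOpen_image_reducedDomain.measurableSet.compl.inter
    (MeasurableSet.const _))
  exact (isOpenQuotientMap_orbitMap.isOpenMap _ (isOpen_reducedDomain.inter hU)).measurableSet

/-- The lift of a measure on the space of lattices to `SL(2, ℝ)`. -/
noncomputable def liftMeasure (ν : Measure (UnimodularLattice 2)) : Measure SL(2, ℝ) :=
  Measure.sum fun γ : sl2Int => ν.map fun x => reducedSection x * γ

theorem lintegral_liftMeasure (ν : Measure (UnimodularLattice 2)) {φ : SL(2, ℝ) → ENNReal}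
    (hφ : Measurable φ) :
    ∫⁻ g, φ g ∂liftMeasure ν = ∫⁻ x, ∑' γ : sl2Int, φ (reducedSection x * γ) ∂ν := by
  rw [liftMeasure, lintegral_sum_measure, lintegral_tsum]
  · refine tsum_congr fun γ => ?_
    rw [lintegral_map hφ (measurable_reducedSection.mul_const _)]
  · exact fun γ => (hφ.comp (measurable_reducedSection.mul_const _)).aemeasurable

theorem liftMeasure_apply (ν : Measure (UnimodularLattice 2)) {B : Set SL(2, ℝ)}
    (hB : MeasurableSet B) : liftMeasure ν B =
      ∫⁻ x, ∑' γ : sl2Int, B.indicator 1 (reducedSection x * γ) ∂ν := by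
  rw [← lintegral_liftMeasure ν (measurable_one.indicator hB), lintegral_indicator_one hB]

/-- With $\sigma$ the section, $h\,\sigma(x)=\sigma(hx)\,c$ for some $c\in SL(2,\mathbb Z)$.
Multiplication by $c$ permutes the sum over $SL(2,\mathbb Z)$, and invariance of $\nu$ absorbs
$x\mapsto hx$. -/
theorem isMulLeftInvariant_liftMeasure (h0 : sl2Haar reducedDomain ≠ 0)
    {ν : Measure (UnimodularLattice 2)} (hν : IsInvariantProbability ν) :
    (liftMeasure ν).IsMulLeftInvariant where
  map_mul_left_eq_self h := by
    have := hν.1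
    have := hν.2
    have hae := ae_mem_image_reducedDomain h0 hν
    have hmp : MeasurePreserving (fun x : UnimodularLattice 2 => h • x) ν ν :=
      ⟨measurable_const_smul_lattice h, by
        ext A hA
        rw [Measure.map_apply (measurable_const_smul_lattice h) hA]
        exact SMulInvariantMeasure.measure_preimage_smul h hA⟩
    ext B hB
    have hφ : Measurable (B.indicator (1 : SL(2, ℝ) → ENNReal)) := measurable_one.indicator hB
    have hΦ : Measurable fun x => ∑' γ : sl2Int,
        B.indicator (1 : SL(2, ℝ) → ENNReal) (reducedSection x * γ) :=
      Measurable.tsum fun γ => hφ.comp (measurable_reducedSection.mul_const _)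
    rw [Measure.map_apply (measurable_const_mul h) hB,
      liftMeasure_apply ν (measurable_const_mul h hB), liftMeasure_apply ν hB,
      ← hmp.lintegral_comp hΦ]
    refine lintegral_congr_ae ?_
    filter_upwards [hae, hmp.quasiMeasurePreserving.ae hae] with x hx hhx
    have hc : (reducedSection (h • x))⁻¹ * (h * reducedSection x) ∈ sl2Int := by
      rw [← smul_std_eq_smul_std_iff]
      change orbitMap _ = orbitMap _
      rw [orbitMap_reducedSection hhx, orbitMap_mul, orbitMap_reducedSection hx]
    refine Eq.trans (tsum_congr fun γ => ?_) ((Equiv.mulLeft (⟨_, hc⟩ : sl2Int)).tsum_eq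
      fun γ : sl2Int => B.indicator (1 : SL(2, ℝ) → ENNReal) (reducedSection (h • x) * γ))
    change B.indicator (1 : SL(2, ℝ) → ENNReal) (h * (reducedSection x * γ)) =
      B.indicator 1 (reducedSection (h • x) *
        ((reducedSection (h • x))⁻¹ * (h * reducedSection x) * γ))
    congr 1
    group

/-- Only the $\gamma$ term of the sum meets the translate of the reduced domain by $\gamma$, so
$\nu$ is recovered from its lift. -/
theorem liftMeasure_translate (h0 : sl2Haar reducedDomain ≠ 0)
    {ν : Measure (UnimodularLattice 2)} (hν : IsInvariantProbability ν) {γ : SL(2, ℝ)}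
    (hγ : γ ∈ sl2Int) {A : Set (UnimodularLattice 2)} (hA : MeasurableSet A) :
    liftMeasure ν ((fun g => g * γ⁻¹) ⁻¹' (orbitMap ⁻¹' A ∩ reducedDomain)) = ν A := by
  rw [liftMeasure_apply ν (measurable_mul_const _
    ((measurable_orbitMap hA).inter isOpen_reducedDomain.measurableSet)),
    ← lintegral_indicator_one hA]
  refine lintegral_congr_ae ?_
  filter_upwards [ae_mem_image_reducedDomain h0 hν] with x hx
  rw [tsum_eq_single (⟨γ, hγ⟩ : sl2Int)]
  · have h1 : reducedSection x * γ ∈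
        (fun g => g * γ⁻¹) ⁻¹' (orbitMap ⁻¹' A ∩ reducedDomain) ↔ x ∈ A := by
      simp [orbitMap_reducedSection hx, reducedSection_mem hx]
    by_cases hxA : x ∈ A
    · rw [Set.indicator_of_mem hxA, Set.indicator_of_mem (h1.2 hxA)]; rfl
    · rw [Set.indicator_of_notMem hxA, Set.indicator_of_notMem fun h => hxA (h1.1 h)]
  · rintro ⟨δ, hδ⟩ hne
    refine Set.indicator_of_notMem ?_ _
    rintro ⟨-, h2⟩
    beta_reduce at h2
    have h3 := reducedDomain_injOn (reducedSection_mem hx) h2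
      (by rw [mul_assoc, inv_mul_cancel_left]; exact mul_mem hδ (inv_mem hγ))
    apply hne
    rw [mul_assoc, left_eq_mul, mul_inv_eq_one] at h3
    exact Subtype.ext h3

theorem sigmaFinite_of_translates {m : Measure SL(2, ℝ)}
    (h : ∀ γ ∈ sl2Int, m ((fun g => g * γ⁻¹) ⁻¹' reducedDomain) < ⊤)
    (h' : m (orbitMap ⁻¹' (orbitMap '' reducedDomain)ᶜ) = 0) : SigmaFinite m := by
  refine Measure.sigmaFinite_of_countable
    (S := insert (orbitMap ⁻¹' (orbitMap '' reducedDomain)ᶜ)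
      (Set.range fun γ : sl2Int => (fun g => g * (γ : SL(2, ℝ))⁻¹) ⁻¹' reducedDomain))
    ((Set.countable_range _).insert _) ?_ ?_
  · rintro s (rfl | ⟨γ, rfl⟩)
    · rw [h']; exact ENNReal.zero_lt_top
    · exact h γ γ.2
  · refine Set.eq_univ_iff_forall.2 fun g => ?_
    by_cases hg : orbitMap g ∈ orbitMap '' reducedDomain
    · obtain ⟨k, hk, hkg⟩ := hg
      refine ⟨_, Or.inr ⟨⟨k⁻¹ * g, (smul_std_eq_smul_std_iff _ _).1 hkg⟩, rfl⟩, ?_⟩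
      simpa using hk
    · exact ⟨_, Or.inl rfl, hg⟩

theorem IsInvariantProbability.eq_invariantMeasure (h0 : sl2Haar reducedDomain ≠ 0)
    (htop : sl2Haar reducedDomain ≠ ⊤) {ν : Measure (UnimodularLattice 2)}
    (hν : IsInvariantProbability ν) : ν = invariantMeasure := by
  have := hν.1
  have hEm : MeasurableSet (orbitMap '' reducedDomain)ᶜ :=
    isOpen_image_reducedDomain.measurableSet.compl
  have hs1 : SigmaFinite sl2Haar := by
    refine sigmaFinite_of_translates (fun γ _ => ?_) sl2Haar_preimage_compl
    rw [measure_preimage_mul_right]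
    exact htop.lt_top
  have hl : ∀ γ ∈ sl2Int, liftMeasure ν ((fun g => g * γ⁻¹) ⁻¹' reducedDomain) = 1 := by
    intro γ hγ
    have := liftMeasure_translate h0 hν hγ MeasurableSet.univ
    rwa [Set.preimage_univ, Set.univ_inter, measure_univ] at this
  have hs2 : SigmaFinite (liftMeasure ν) := by
    refine sigmaFinite_of_translates (fun γ hγ => ?_) ?_
    · rw [hl γ hγ]; exact ENNReal.one_lt_top
    · rw [liftMeasure_apply ν (measurable_orbitMap hEm), ← lintegral_zero (μ := ν)]
      refine lintegral_congr_ae ?_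
      filter_upwards [ae_mem_image_reducedDomain h0 hν] with x hx
      refine ENNReal.tsum_eq_zero.2 fun γ => Set.indicator_of_notMem ?_ _
      rw [Set.mem_preimage, Set.mem_compl_iff, not_not, orbitMap_mul_of_mem _ γ.2, orbitMap_reducedSection hx]
      exact hx
  have hinv := isMulLeftInvariant_liftMeasure h0 hν
  -- Two σ-finite left-invariant measures are proportional; the reduced domain, of mass $1$ for the
  -- lift, fixes the constant.
  have heq := measure_eq_div_smul (liftMeasure ν) sl2Haar h0 htop
  have h1 := hl 1 (one_mem _)
  simp only [inv_one, mul_one, Set.preimage_id'] at h1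
  rw [h1, one_div] at heq
  ext A hA
  have h2 := liftMeasure_translate h0 hν (one_mem _) hA
  simp only [inv_one, mul_one, Set.preimage_id'] at h2
  rw [← h2, heq, invariantMeasure_apply hA, Measure.smul_apply, smul_eq_mul]

end UnimodularLattice

/-! ### One-dimensional integrals -/

theorem le_of_nonneg_deriv {F F' : ℝ → ℝ} {a b : ℝ} (hab : a ≤ b)
    (hc : ContinuousOn F (Set.Icc a b)) (hd : ∀ x ∈ Set.Ioo a b, HasDerivAt F (F' x) x)
    (hF : ∀ x ∈ Set.Ioo a b, 0 ≤ F' x) : F a ≤ F b := by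
  refine monotoneOn_of_deriv_nonneg (convex_Icc a b) hc ?_ ?_ (Set.left_mem_Icc.2 hab)
    (Set.right_mem_Icc.2 hab) hab
  · intro x hx
    rw [interior_Icc] at hx
    exact (hd x hx).differentiableAt.differentiableWithinAt
  · intro x hx
    rw [interior_Icc] at hx
    rw [(hd x hx).deriv]
    exact hF x hx

/-- A nonnegative derivative is automatically integrable, so $F'$ may be singular at the endpoints,
as happens below at $0$ and at the roots of the quadratic. -/
theorem setLIntegral_Ioo_deriv {F F' : ℝ → ℝ} {a b : ℝ} (hab : a ≤ b)
    (hc : ContinuousOn F (Set.Icc a b)) (hd : ∀ x ∈ Set.Ioo a b, HasDerivAt F (F' x) x)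
    (hF : ∀ x ∈ Set.Ioo a b, 0 ≤ F' x) :
    ∫⁻ x in Set.Ioo a b, ENNReal.ofReal (F' x) = ENNReal.ofReal (F b - F a) := by
  have hi : IntegrableOn F' (Set.Ioc a b) :=
    intervalIntegral.integrableOn_deriv_of_nonneg hc hd hF
  have h1 : ∫ x in a..b, F' x = F b - F a :=
    intervalIntegral.integral_eq_sub_of_hasDerivAt_of_le hab hc hd
      ((intervalIntegrable_iff_integrableOn_Ioc_of_le hab).2 hi)
  rw [intervalIntegral.integral_of_le hab, integral_Ioc_eq_integral_Ioo] at h1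
  rw [← h1, ofReal_integral_eq_lintegral_ofReal (hi.mono_set Set.Ioo_subset_Ioc_self)]
  filter_upwards [ae_restrict_mem measurableSet_Ioo] with x hx using hF x hx

theorem setLIntegral_eq_of_subset {α : Type*} [MeasurableSpace α] {μ : Measure α} {s t : Set α}
    (ht : MeasurableSet t) (hs : MeasurableSet s) (hst : s ⊆ t) {f : α → ENNReal}
    (h : ∀ x ∈ t \ s, f x = 0) : ∫⁻ x in t, f x ∂μ = ∫⁻ x in s, f x ∂μ := by
  rw [← lintegral_indicator ht, ← lintegral_indicator hs]
  refine lintegral_congr fun x => ?_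
  by_cases hx : x ∈ s
  · rw [Set.indicator_of_mem hx, Set.indicator_of_mem (hst hx)]
  · rw [Set.indicator_of_notMem hx]
    by_cases hxt : x ∈ t
    · rw [Set.indicator_of_mem hxt, h x ⟨hxt, hx⟩]
    · rw [Set.indicator_of_notMem hxt]

theorem hasDerivAt_arcsin_comp {u : ℝ → ℝ} {u' w x : ℝ} (hu : HasDerivAt u u' x) (hw : 0 < w)
    (h : w ^ 2 = 1 - u x ^ 2) : HasDerivAt (fun y => Real.arcsin (u y)) (u' / w) x := by
  have h1 : u x ≠ -1 := by
    intro h1; rw [h1] at h; nlinarith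
  have h2 : u x ≠ 1 := by
    intro h1; rw [h1] at h; nlinarith
  have h3 := (Real.hasDerivAt_arcsin h1 h2).comp x hu
  rw [← h, Real.sqrt_sq hw.le] at h3
  exact h3.congr_deriv (by ring)

/-- The quadratic polynomial controlling the length of the sections. -/
def sectionQuad (R e : ℝ) : ℝ := R ^ 2 + 2 * R * e - 3 * e ^ 2 - 4

theorem hasDerivAt_sqrt_sectionQuad {R e : ℝ} (h : 0 < sectionQuad R e) :
    HasDerivAt (fun e => √(sectionQuad R e)) ((R - 3 * e) / √(sectionQuad R e)) e := by
  have h1 : HasDerivAt (sectionQuad R) (2 * R - 6 * e) e := by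
    have h2 := ((((hasDerivAt_id' e).const_mul (2 * R)).const_add (R ^ 2)).sub
      (((hasDerivAt_id' e).pow 2).const_mul 3)).sub_const 4
    exact h2.congr_deriv (by push_cast; ring)
  refine (h1.sqrt h.ne').congr_deriv ?_
  have := (Real.sqrt_pos.2 h).ne'
  field_simp
  ring

theorem continuous_sectionQuad (R : ℝ) : Continuous (sectionQuad R) := by
  unfold sectionQuad; fun_prop

theorem three_mul_sectionQuad (R e ρ : ℝ) (hρ : ρ ^ 2 = R ^ 2 - 3) :
    3 * sectionQuad R e = (2 * ρ) ^ 2 - (3 * e - R) ^ 2 := by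
  rw [sectionQuad, mul_pow, hρ]; ring

theorem hasDerivAt_arcsin_sectionQuad {R e ρ : ℝ} (hρ0 : 0 < ρ) (hρ : ρ ^ 2 = R ^ 2 - 3)
    (h : 0 < sectionQuad R e) :
    HasDerivAt (fun e => R / √3 * Real.arcsin ((3 * e - R) / (2 * ρ)))
      (R / √(sectionQuad R e)) e := by
  have h3 : 0 < √(3 : ℝ) := Real.sqrt_pos.2 (by norm_num)
  have h3' : √(3 : ℝ) ^ 2 = 3 := Real.sq_sqrt (by norm_num)
  have hq := Real.sqrt_pos.2 h
  have hq' : √(sectionQuad R e) ^ 2 = sectionQuad R e := Real.sq_sqrt h.le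
  have hu : HasDerivAt (fun e : ℝ => (3 * e - R) / (2 * ρ)) (3 / (2 * ρ)) e := by
    have := (((hasDerivAt_id' e).const_mul 3).sub_const R).div_const (2 * ρ)
    exact this.congr_deriv (by ring)
  have h1 := (hasDerivAt_arcsin_comp hu (w := √3 * √(sectionQuad R e) / (2 * ρ)) (by positivity) (by
    rw [div_pow, div_pow, mul_pow, h3', hq', three_mul_sectionQuad R e ρ hρ]
    field_simp)).const_mul (R / √3)
  refine h1.congr_deriv ?_
  field_simp
  rw [h3']

/-! ### Integrals of the section lengths -/

theorem sqrt_sectionQuad_eq_zero {R e : ℝ} (h : sectionQuad R e ≤ 0) :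
    √(sectionQuad R e) = 0 := Real.sqrt_eq_zero_of_nonpos h

theorem lintegral_section_small {R : ℝ} (hR0 : 0 ≤ R) (hR : R ≤ √3) :
    ∫⁻ e in Set.Ioi (0 : ℝ), ENNReal.ofReal (√(sectionQuad R e) / e) = 0 := by
  have h3 : R ^ 2 ≤ 3 := by
    have := Real.sq_sqrt (show (0 : ℝ) ≤ 3 by norm_num)
    nlinarith
  have h : ∀ e, √(sectionQuad R e) = 0 := fun e => sqrt_sectionQuad_eq_zero (by
    rw [sectionQuad]; nlinarith [sq_nonneg (3 * e - R)])
  simp [h]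

theorem lintegral_section_mid {R : ℝ} (hR : √3 < R) (hR2 : R < 2) :
    ∫⁻ e in Set.Ioi (0 : ℝ), ENNReal.ofReal (√(sectionQuad R e) / e) =
      ENNReal.ofReal (Real.pi * (R / √3 - √(4 - R ^ 2))) := by
  have h30 : 0 < √(3 : ℝ) := Real.sqrt_pos.2 (by norm_num)
  have h3' : √(3 : ℝ) ^ 2 = 3 := Real.sq_sqrt (by norm_num)
  have hR0 : 0 < R := h30.trans hR
  have hRsq : 3 < R ^ 2 := by nlinarith
  have hRsq4 : R ^ 2 < 4 := by nlinarith
  set h := √(4 - R ^ 2) with hh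
  have hh0 : 0 < h := Real.sqrt_pos.2 (by linarith)
  have hh2 : h ^ 2 = 4 - R ^ 2 := Real.sq_sqrt (by linarith)
  obtain ⟨ρ, hρ0, hρ⟩ : ∃ ρ : ℝ, 0 < ρ ∧ ρ ^ 2 = R ^ 2 - 3 :=
    ⟨√(R ^ 2 - 3), Real.sqrt_pos.2 (by linarith), Real.sq_sqrt (by linarith)⟩
  have hρR : 2 * ρ < R := by nlinarith
  set e₁ := (R - 2 * ρ) / 3 with he₁
  set e₂ := (R + 2 * ρ) / 3 with he₂
  have he₁0 : 0 < e₁ := by rw [he₁]; linarith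
  have he₁₂ : e₁ < e₂ := by rw [he₁, he₂]; linarith
  have hfac : ∀ e, sectionQuad R e = 3 * ((e - e₁) * (e₂ - e)) := by
    intro e
    have := three_mul_sectionQuad R e ρ hρ
    rw [he₁, he₂]
    linarith
  have hpos : ∀ e ∈ Set.Ioo e₁ e₂, 0 < sectionQuad R e := by
    intro e he
    rw [hfac]
    have := mul_pos (sub_pos.2 he.1) (sub_pos.2 he.2)
    linarith
  have hsub : Set.Ioo e₁ e₂ ⊆ Set.Ioi 0 := fun e he => he₁0.trans he.1
  rw [setLIntegral_eq_of_subset measurableSet_Ioi measurableSet_Ioo hsub]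
  swap
  · intro e he
    have hq : sectionQuad R e ≤ 0 := by
      rw [hfac]
      by_contra hc
      push Not at hc
      have hc' : 0 < (e - e₁) * (e₂ - e) := by linarith
      rcases pos_and_pos_or_neg_and_neg_of_mul_pos hc' with ⟨h1, h2⟩ | ⟨h1, h2⟩
      · exact he.2 ⟨by linarith, by linarith⟩
      · linarith
    rw [sqrt_sectionQuad_eq_zero hq]
    simp
  -- Both arcsine arguments run from $-1$ to $1$ between the roots $e_1<e_2$, which are positive
  -- because $R<2$; each arcsine contributes $\pi$ and the square root vanishes at both ends.
  have key := setLIntegral_Ioo_deriv (a := e₁) (b := e₂)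
    (F := fun e => √(sectionQuad R e) + R / √3 * Real.arcsin ((3 * e - R) / (2 * ρ)) -
      h * Real.arcsin ((R * e - h ^ 2) / (2 * ρ * e)))
    (F' := fun e => √(sectionQuad R e) / e) he₁₂.le ?_ ?_ ?_
  · rw [key]
    congr 1
    have hz₁ : sectionQuad R e₁ = 0 := by rw [hfac]; ring
    have hz₂ : sectionQuad R e₂ = 0 := by rw [hfac]; ring
    have a1 : (3 * e₁ - R) / (2 * ρ) = -1 := by rw [he₁]; field_simp; ring
    have a2 : (3 * e₂ - R) / (2 * ρ) = 1 := by rw [he₂]; field_simp; ring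
    have b1 : (R * e₁ - h ^ 2) / (2 * ρ * e₁) = -1 := by
      rw [div_eq_iff (by positivity)]
      rw [sectionQuad] at hz₁
      have : 2 * ρ = R - 3 * e₁ := by rw [he₁]; ring
      rw [this, hh2]
      linarith
    have b2 : (R * e₂ - h ^ 2) / (2 * ρ * e₂) = 1 := by
      rw [div_eq_iff (by positivity)]
      rw [sectionQuad] at hz₂
      have : 2 * ρ = 3 * e₂ - R := by rw [he₂]; ring
      rw [this, hh2]
      linarith
    simp only [hz₁, hz₂, a1, a2, b1, b2, Real.arcsin_one, Real.arcsin_neg, Real.sqrt_zero]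
    ring
  · refine ContinuousOn.sub (Continuous.continuousOn ?_) (ContinuousOn.mul continuousOn_const ?_)
    · have := continuous_sectionQuad R
      have := Real.continuous_arcsin
      fun_prop
    · refine Real.continuous_arcsin.comp_continuousOn (ContinuousOn.div (by fun_prop)
        (by fun_prop) fun e he => ?_)
      have : 0 < e := he₁0.trans_le he.1
      positivity
  · intro e he
    have he0 : 0 < e := hsub he
    have hq := hpos e he
    have hq0 := Real.sqrt_pos.2 hq
    have hq2 : √(sectionQuad R e) ^ 2 = sectionQuad R e := Real.sq_sqrt hq.le
    have hu : HasDerivAt (fun e : ℝ => (R * e - h ^ 2) / (2 * ρ * e)) (h ^ 2 / (2 * ρ * e ^ 2)) e := by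
      have := (((hasDerivAt_id' e).const_mul R).sub_const (h ^ 2)).div
        ((hasDerivAt_id' e).const_mul (2 * ρ)) (by positivity)
      refine this.congr_deriv ?_
      field_simp
      ring
    have d3 := (hasDerivAt_arcsin_comp hu (w := h * √(sectionQuad R e) / (2 * ρ * e))
      (by positivity) (by
        rw [div_pow, div_pow, mul_pow, hq2]
        rw [eq_sub_iff_add_eq, ← add_div, div_eq_one_iff_eq (by positivity), mul_pow, mul_pow, hρ,
          sectionQuad]
        have : h ^ 2 = 4 - R ^ 2 := hh2
        rw [this]
        ring)).const_mul h
    have d := ((hasDerivAt_sqrt_sectionQuad hq).add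
      (hasDerivAt_arcsin_sectionQuad hρ0 hρ hq)).sub d3
    refine d.congr_deriv ?_
    field_simp
    rw [hq2, hh2, sectionQuad]
    ring
  · intro e he
    have : 0 < e := hsub he
    positivity

/-- With $\theta$ the arccosine on the right, the three arcsines are $\theta-\pi/6$, $\theta+\pi/6$
and $\pi/2-\theta$. The bound $\theta\le\pi/3$ keeps them in the principal range. -/
theorem arcsin_sum_eq {R s ρ : ℝ} (hs : 0 < s) (hR : 0 < R) (hρ0 : 0 < ρ)
    (hsR : s ^ 2 = R ^ 2 - 4) (hρ : ρ ^ 2 = R ^ 2 - 3) :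
    Real.arcsin ((R - 3 * s) / (4 * ρ)) + Real.arcsin (R / (2 * ρ)) -
      Real.arcsin ((R + 3 * s) / (4 * ρ)) + Real.pi / 2 =
    3 * Real.arccos ((R + 3 * s) / (4 * ρ)) := by
  have h30 : 0 < √(3 : ℝ) := Real.sqrt_pos.2 (by norm_num)
  have h3' : √(3 : ℝ) ^ 2 = 3 := Real.sq_sqrt (by norm_num)
  have hsltR : s < R := by nlinarith
  set c := (R + 3 * s) / (4 * ρ) with hc
  set θ := Real.arccos c with hθ
  have hc1 : c ≤ 1 := by
    rw [hc, div_le_one (by positivity)]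
    nlinarith [sq_nonneg (R - s), mul_pos hs hR]
  have hc2 : 1 / 2 ≤ c := by
    rw [hc, le_div_iff₀ (by positivity)]
    nlinarith [mul_pos hs hR]
  have hcos : Real.cos θ = c := Real.cos_arccos (by linarith) hc1
  have hsin : Real.sin θ = √3 * (R - s) / (4 * ρ) := by
    rw [hθ, Real.sin_arccos]
    rw [Real.sqrt_eq_iff_mul_self_eq_of_pos]
    · rw [hc]
      field_simp
      have : ρ ^ 2 * 4 ^ 2 - (R + 3 * s) ^ 2 = √3 ^ 2 * (R - s) ^ 2 := by
        rw [h3', hρ]; linear_combination (-12 : ℝ) * hsR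
      linarith
    · have := sub_pos.2 hsltR
      positivity
  have hθ0 : 0 ≤ θ := Real.arccos_nonneg c
  have hθ3 : θ ≤ Real.pi / 3 := by
    have h1 : Real.arccos (1 / 2) = Real.pi / 3 := by
      rw [← Real.cos_pi_div_three, Real.arccos_cos (by positivity) (by linarith [Real.pi_pos])]
    rw [← h1]
    exact Real.arccos_le_arccos hc2
  have hpi := Real.pi_pos
  have e1 : Real.arcsin c = Real.pi / 2 - θ := by
    rw [hθ, Real.arccos]; ring
  have e2 : Real.arcsin (R / (2 * ρ)) = θ + Real.pi / 6 := by
    refine Real.arcsin_eq_of_sin_eq ?_ ⟨by linarith, by linarith⟩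
    rw [Real.sin_add, hcos, hsin, Real.cos_pi_div_six, Real.sin_pi_div_six, hc]
    field_simp
    rw [h3']
    ring
  have e3 : Real.arcsin ((R - 3 * s) / (4 * ρ)) = θ - Real.pi / 6 := by
    refine Real.arcsin_eq_of_sin_eq ?_ ⟨by linarith, by linarith⟩
    rw [Real.sin_sub, hcos, hsin, Real.cos_pi_div_six, Real.sin_pi_div_six, hc]
    field_simp
    rw [h3']
    ring
  rw [e1, e2, e3]
  ring

/-- An antiderivative of `(√q - s) / e`. -/
noncomputable def sectionPrimitive (R s ρ e : ℝ) : ℝ :=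
  √(sectionQuad R e) + R / √3 * Real.arcsin ((3 * e - R) / (2 * ρ)) -
    s * Real.log (s ^ 2 + R * e + s * √(sectionQuad R e))

theorem hasDerivAt_sectionPrimitive {R s ρ e : ℝ} (hs : 0 < s) (hR : 0 < R) (hρ0 : 0 < ρ)
    (hsR : s ^ 2 = R ^ 2 - 4) (hρ : ρ ^ 2 = R ^ 2 - 3) (he : 0 < e) (hq : 0 < sectionQuad R e) :
    HasDerivAt (sectionPrimitive R s ρ) ((√(sectionQuad R e) - s) / e) e := by
  have hq0 := Real.sqrt_pos.2 hq
  have hq2 : √(sectionQuad R e) ^ 2 = sectionQuad R e := Real.sq_sqrt hq.le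
  have d1 := hasDerivAt_sqrt_sectionQuad hq
  have hN : 0 < s ^ 2 + R * e + s * √(sectionQuad R e) := by positivity
  have d3 := (((((hasDerivAt_id' e).const_mul R).const_add (s ^ 2)).add
    (d1.const_mul s)).log hN.ne').const_mul s
  have d := (d1.add (hasDerivAt_arcsin_sectionQuad hρ0 hρ hq)).sub d3
  refine d.congr_deriv ?_
  simp only [Pi.add_apply]
  set w := √(sectionQuad R e) with hw
  have hw2 : w ^ 2 = s ^ 2 + 2 * R * e - 3 * e ^ 2 := by
    rw [hq2, sectionQuad, hsR]; ring
  have h1 : (R * 1 + s * ((R - 3 * e) / w)) / (s ^ 2 + R * e + s * w) = (w - s) / (e * w) := by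
    rw [div_eq_div_iff hN.ne' (by positivity)]
    field_simp
    linear_combination (-(s : ℝ)) * hw2
  rw [h1]
  field_simp
  linear_combination (-1 : ℝ) * hw2

theorem continuousOn_sectionPrimitive {R s ρ : ℝ} (hs : 0 < s) (hR : 0 < R) :
    ContinuousOn (sectionPrimitive R s ρ) (Set.Ici 0) := by
  unfold sectionPrimitive
  have h1 := continuous_sectionQuad R
  have h2 := Real.continuous_arcsin
  refine ContinuousOn.sub (Continuous.continuousOn (by fun_prop))
    (ContinuousOn.mul continuousOn_const (ContinuousOn.log (Continuous.continuousOn (by fun_prop)) ?_))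
  intro e he
  have : 0 ≤ e := he
  positivity

theorem setLIntegral_union_Ioo {a b c : ℝ} (hab : a < b) (hbc : b < c) (f : ℝ → ENNReal) :
    ∫⁻ x in Set.Ioo a c, f x = (∫⁻ x in Set.Ioo a b, f x) + ∫⁻ x in Set.Ioo b c, f x := by
  rw [← Set.Ioc_union_Ioo_eq_Ioo hab.le hbc, lintegral_union measurableSet_Ioo]
  · rw [setLIntegral_congr Ioo_ae_eq_Ioc.symm]
  · exact Set.disjoint_left.2 fun x hx hx' => absurd hx.2 (not_le.2 hx'.1)

theorem lintegral_section_large {R s ρ : ℝ} (hs : 0 < s) (hR : 0 < R) (hρ0 : 0 < ρ)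
    (hsR : s ^ 2 = R ^ 2 - 4) (hρ : ρ ^ 2 = R ^ 2 - 3) :
    0 ≤ R * √3 * Real.arccos ((R + 3 * s) / (4 * ρ)) + 3 / 2 * s * Real.log (s ^ 2 / ρ ^ 2) ∧
    ∫⁻ e in Set.Ioi (0 : ℝ), (ENNReal.ofReal ((√(sectionQuad R e) - e - s) / e) +
      ENNReal.ofReal (min (√(sectionQuad R e)) (e - s) / e)) =
      ENNReal.ofReal (R * √3 * Real.arccos ((R + 3 * s) / (4 * ρ)) +
        3 / 2 * s * Real.log (s ^ 2 / ρ ^ 2)) := by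
  have h30 : 0 < √(3 : ℝ) := Real.sqrt_pos.2 (by norm_num)
  have h3' : √(3 : ℝ) ^ 2 = 3 := Real.sq_sqrt (by norm_num)
  have hsltR : s < R := by nlinarith
  have hsρ : s < ρ := by nlinarith
  -- With $w=\sqrt q$: $w=e+s$ at $e_1$, $w=e-s$ at $e_2$, and $w=0$ at $e_3$. The first integrand
  -- lives on $(0,e_1)$; the second is $(e-s)/e$ on $(s,e_2)$ and $w/e$ on $(e_2,e_3)$.
  set e₁ := (R - s) / 2 with he₁
  set e₂ := (R + s) / 2 with he₂
  set e₃ := (R + 2 * ρ) / 3 with he₃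
  have he₁0 : 0 < e₁ := by rw [he₁]; linarith
  have hse₂ : s < e₂ := by rw [he₂]; linarith
  have he₁₃ : e₁ < e₃ := by rw [he₁, he₃]; nlinarith
  have he₂₃ : e₂ < e₃ := by
    rw [he₂, he₃]
    have : R + 3 * s < 4 * ρ := by nlinarith [sq_nonneg (R - s), mul_pos hs hR]
    linarith
  have hfac : ∀ e, sectionQuad R e = 3 * ((e - (R - 2 * ρ) / 3) * (e₃ - e)) := by
    intro e
    have := three_mul_sectionQuad R e ρ hρ
    rw [he₃]
    linarith
  have hneg : (R - 2 * ρ) / 3 < 0 := by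
    have : R < 2 * ρ := by nlinarith
    linarith
  have hpos : ∀ e, 0 ≤ e → e < e₃ → 0 < sectionQuad R e := by
    intro e h0 h3
    rw [hfac]
    have := mul_pos (show 0 < e - (R - 2 * ρ) / 3 by linarith) (sub_pos.2 h3)
    linarith
  have hzero : ∀ e, e₃ ≤ e → √(sectionQuad R e) = 0 := by
    intro e h3
    refine sqrt_sectionQuad_eq_zero ?_
    rw [hfac]
    have : 0 < e₃ := he₁0.trans he₁₃
    have := mul_nonneg (show 0 ≤ e - (R - 2 * ρ) / 3 by linarith) (sub_nonneg.2 h3)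
    linarith
  have hdiff₁ : ∀ e, sectionQuad R e - (e + s) ^ 2 = 4 * e * (e₁ - e) := by
    intro e
    rw [sectionQuad, he₁]; linear_combination (-1 : ℝ) * hsR
  have hdiff₂ : ∀ e, sectionQuad R e - (e - s) ^ 2 = 4 * e * (e₂ - e) := by
    intro e
    rw [sectionQuad, he₂]; linear_combination (-1 : ℝ) * hsR
  have hv₁ : √(sectionQuad R e₁) = e₁ + s := by
    rw [Real.sqrt_eq_iff_mul_self_eq_of_pos (by linarith)]
    have := hdiff₁ e₁
    rw [sub_self, mul_zero] at this
    linarith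
  have hv₂ : √(sectionQuad R e₂) = e₂ - s := by
    rw [Real.sqrt_eq_iff_mul_self_eq_of_pos (by linarith)]
    have := hdiff₂ e₂
    rw [sub_self, mul_zero] at this
    linarith
  have hv₀ : √(sectionQuad R 0) = s := by
    rw [Real.sqrt_eq_iff_mul_self_eq_of_pos hs, sectionQuad]
    linarith
  have hcont := continuousOn_sectionPrimitive (ρ := ρ) hs hR
  have hderiv := fun e h0 hq => hasDerivAt_sectionPrimitive (e := e) hs hR hρ0 hsR hρ h0 hq
  have J₁c : ContinuousOn (fun e => sectionPrimitive R s ρ e - e) (Set.Icc 0 e₁) :=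
    (hcont.mono fun e he => he.1).sub continuousOn_id
  have J₁d : ∀ e ∈ Set.Ioo 0 e₁, HasDerivAt (fun e => sectionPrimitive R s ρ e - e)
      ((√(sectionQuad R e) - e - s) / e) e := by
    intro e he
    have he0 : 0 < e := he.1
    refine ((hderiv e he0 (hpos e he0.le (he.2.trans he₁₃))).sub (hasDerivAt_id' e)).congr_deriv ?_
    field_simp
    ring
  have J₁p : ∀ e ∈ Set.Ioo 0 e₁, 0 ≤ (√(sectionQuad R e) - e - s) / e := by
    intro e he
    have he0 : 0 < e := he.1
    refine div_nonneg ?_ he0.le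
    have : e + s ≤ √(sectionQuad R e) := by
      refine Real.le_sqrt_of_sq_le ?_
      have := mul_pos he0 (sub_pos.2 he.2)
      linarith [hdiff₁ e]
    linarith
  have J₂c : ContinuousOn (fun e => e - s * Real.log e) (Set.Icc s e₂) := by
    refine continuousOn_id.sub (continuousOn_const.mul (continuousOn_id.log fun e he => ?_))
    exact (hs.trans_le he.1).ne'
  have J₂d : ∀ e ∈ Set.Ioo s e₂, HasDerivAt (fun e => e - s * Real.log e) ((e - s) / e) e := by
    intro e he
    have he0 : 0 < e := hs.trans he.1
    refine ((hasDerivAt_id' e).sub ((Real.hasDerivAt_log he0.ne').const_mul s)).congr_deriv ?_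
    field_simp
  have J₂p : ∀ e ∈ Set.Ioo s e₂, 0 ≤ (e - s) / e := fun e he =>
    div_nonneg (sub_nonneg.2 he.1.le) (hs.trans he.1).le
  have J₃c : ContinuousOn (fun e => sectionPrimitive R s ρ e + s * Real.log e) (Set.Icc e₂ e₃) := by
    refine (hcont.mono fun e he => ?_).add (continuousOn_const.mul (continuousOn_id.log fun e he => ?_))
    · exact (hs.trans hse₂).le.trans he.1
    · exact ((hs.trans hse₂).trans_le he.1).ne'
  have J₃d : ∀ e ∈ Set.Ioo e₂ e₃, HasDerivAt (fun e => sectionPrimitive R s ρ e + s * Real.log e)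
      (√(sectionQuad R e) / e) e := by
    intro e he
    have he0 : 0 < e := (hs.trans hse₂).trans he.1
    refine ((hderiv e he0 (hpos e he0.le he.2)).add
      ((Real.hasDerivAt_log he0.ne').const_mul s)).congr_deriv ?_
    field_simp
    ring
  have J₃p : ∀ e ∈ Set.Ioo e₂ e₃, 0 ≤ √(sectionQuad R e) / e := fun e he =>
    div_nonneg (Real.sqrt_nonneg _) ((hs.trans hse₂).trans he.1).le
  have n₁ := le_of_nonneg_deriv he₁0.le J₁c J₁d J₁p
  have n₂ := le_of_nonneg_deriv hse₂.le J₂c J₂d J₂p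
  have n₃ := le_of_nonneg_deriv he₂₃.le J₃c J₃d J₃p
  have i₁ := setLIntegral_Ioo_deriv he₁0.le J₁c J₁d J₁p
  have i₂ := setLIntegral_Ioo_deriv hse₂.le J₂c J₂d J₂p
  have i₃ := setLIntegral_Ioo_deriv he₂₃.le J₃c J₃d J₃p
  have total : (sectionPrimitive R s ρ e₁ - e₁ - (sectionPrimitive R s ρ 0 - 0)) +
      ((e₂ - s * Real.log e₂ - (s - s * Real.log s)) +
      (sectionPrimitive R s ρ e₃ + s * Real.log e₃ -
        (sectionPrimitive R s ρ e₂ + s * Real.log e₂))) =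
      R * √3 * Real.arccos ((R + 3 * s) / (4 * ρ)) + 3 / 2 * s * Real.log (s ^ 2 / ρ ^ 2) := by
    have hang := arcsin_sum_eq hs hR hρ0 hsR hρ
    have he₂0 : 0 < e₂ := hs.trans hse₂
    have he₃0 : 0 < e₃ := he₂0.trans he₂₃
    have a₁ : (3 * e₁ - R) / (2 * ρ) = (R - 3 * s) / (4 * ρ) := by
      rw [he₁]; field_simp; ring
    have a₂ : (3 * e₂ - R) / (2 * ρ) = (R + 3 * s) / (4 * ρ) := by
      rw [he₂]; field_simp; ring
    have a₃ : (3 * e₃ - R) / (2 * ρ) = 1 := by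
      rw [he₃]; field_simp; ring
    have a₀ : (3 * 0 - R) / (2 * ρ) = -(R / (2 * ρ)) := by ring
    -- At the four endpoints the argument of the logarithm factors, so the terms in $\log 2$, $\log
    -- e_2$ and $\log e_3$ cancel and only $3s(\log s-\log\rho)$ remains.
    have l₀ : s ^ 2 + R * 0 + s * s = 2 * s ^ 2 := by ring
    have l₁ : s ^ 2 + R * e₁ + s * (e₁ + s) = 2 * ρ ^ 2 := by
      rw [he₁]; linear_combination (3 / 2 : ℝ) * hsR - 2 * hρ
    have l₂ : s ^ 2 + R * e₂ + s * (e₂ - s) = 2 * e₂ ^ 2 := by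
      rw [he₂]; ring
    have l₃ : s ^ 2 + R * e₃ + s * 0 = 2 * ρ * e₃ := by
      rw [he₃]; linear_combination hsR - (4 / 3 : ℝ) * hρ
    have hv₃ := hzero e₃ le_rfl
    simp only [sectionPrimitive, hv₀, hv₁, hv₂, hv₃, a₀, a₁, a₂, a₃, l₀, l₁, l₂, l₃,
      Real.arcsin_neg, Real.arcsin_one]
    have g₀ : Real.log (2 * s ^ 2) = Real.log 2 + 2 * Real.log s := by
      rw [Real.log_mul two_ne_zero (by positivity), Real.log_pow]; push_cast; rfl
    have g₁ : Real.log (2 * ρ ^ 2) = Real.log 2 + 2 * Real.log ρ := by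
      rw [Real.log_mul two_ne_zero (by positivity), Real.log_pow]; push_cast; rfl
    have g₂ : Real.log (2 * e₂ ^ 2) = Real.log 2 + 2 * Real.log e₂ := by
      rw [Real.log_mul two_ne_zero (by positivity), Real.log_pow]; push_cast; rfl
    have g₃ : Real.log (2 * ρ * e₃) = Real.log 2 + Real.log ρ + Real.log e₃ := by
      rw [Real.log_mul (by positivity) (by positivity), Real.log_mul two_ne_zero (by positivity)]
    have g₄ : Real.log (s ^ 2 / ρ ^ 2) = 2 * Real.log s - 2 * Real.log ρ := by
      rw [Real.log_div (by positivity) (by positivity), Real.log_pow, Real.log_pow]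
      push_cast; rfl
    rw [g₀, g₁, g₂, g₃, g₄]
    have h3R : R * √3 * Real.arccos ((R + 3 * s) / (4 * ρ)) =
        R / √3 * (3 * Real.arccos ((R + 3 * s) / (4 * ρ))) := by
      field_simp
      rw [h3']
    rw [h3R, ← hang]
    ring
  refine ⟨by rw [← total]; linarith, ?_⟩
  rw [← total, ENNReal.ofReal_add (by linarith) (by linarith),
    ENNReal.ofReal_add (by linarith) (by linarith), ← i₁, ← i₂, ← i₃, lintegral_add_left]
  · congr 1
    · refine setLIntegral_eq_of_subset measurableSet_Ioi measurableSet_Ioo (fun e he => he.1) ?_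
      rintro e ⟨h0, h1⟩
      have h0' : (0 : ℝ) < e := h0
      have h1' : e₁ ≤ e := not_lt.1 fun h => h1 ⟨h0, h⟩
      refine ENNReal.ofReal_of_nonpos (div_nonpos_of_nonpos_of_nonneg ?_ h0'.le)
      have : √(sectionQuad R e) ≤ e + s := by
        refine Real.sqrt_le_iff.2 ⟨by linarith, ?_⟩
        have := mul_nonneg h0'.le (sub_nonneg.2 h1')
        linarith [hdiff₁ e]
      linarith
    · rw [setLIntegral_eq_of_subset (s := Set.Ioo s e₃) measurableSet_Ioi measurableSet_Ioo
        (fun e he => hs.trans he.1), setLIntegral_union_Ioo hse₂ he₂₃]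
      · congr 1
        · refine setLIntegral_congr_fun measurableSet_Ioo fun e he => ?_
          have he0 : 0 < e := hs.trans he.1
          have : e - s ≤ √(sectionQuad R e) := by
            refine Real.le_sqrt_of_sq_le ?_
            have := mul_pos he0 (sub_pos.2 he.2)
            linarith [hdiff₂ e]
          simp only [min_eq_right this]
        · refine setLIntegral_congr_fun measurableSet_Ioo fun e he => ?_
          have he0 : 0 < e := (hs.trans hse₂).trans he.1
          have : √(sectionQuad R e) ≤ e - s := by
            refine Real.sqrt_le_iff.2 ⟨by linarith [he.1], ?_⟩
            have := mul_pos he0 (sub_pos.2 he.1)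
            linarith [hdiff₂ e]
          simp only [min_eq_left this]
      · rintro e ⟨h0, h1⟩
        have h0' : (0 : ℝ) < e := h0
        refine ENNReal.ofReal_of_nonpos (div_nonpos_of_nonpos_of_nonneg ?_ h0'.le)
        rcases le_or_gt e s with h | h
        · exact (min_le_right _ _).trans (by linarith)
        · refine (min_le_left _ _).trans (hzero e ?_).le
          exact not_lt.1 fun h' => h1 ⟨h, h'⟩
  · have := (continuous_sectionQuad R).measurable
    fun_prop

/-! ### The distribution of the radius under Haar measure -/

theorem measurableSet_entry_lt (i j k l : Fin 2) : MeasurableSet {g : SL(2, ℝ) | g i j < g k l} := by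
  have h : ∀ i j, Continuous fun g : SL(2, ℝ) => g i j := by intro i j; fun_prop
  exact (isOpen_lt (h i j) (h k l)).measurableSet

theorem sl2Haar_symmetric_null : sl2Haar {g | g 0 1 = g 1 0} = 0 := by
  have h : ∀ i j, Continuous fun g : SL(2, ℝ) => g i j := by intro i j; fun_prop
  have hm : MeasurableSet {g : SL(2, ℝ) | g 0 1 = g 1 0} :=
    (isClosed_eq (h 0 1) (h 1 0)).measurableSet
  rw [← lintegral_indicator_one hm, lintegral_sl2Haar (measurable_one.indicator hm),
    ← lintegral_zero (α := ℝ) (μ := volume)]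
  have hne : ∀ᵐ a : ℝ, a ≠ 0 := by simp [ae_iff]
  refine lintegral_congr_ae ?_
  filter_upwards [hne] with a ha
  rw [← lintegral_zero (α := ℝ) (μ := volume)]
  refine lintegral_congr fun e => ?_
  rw [← lintegral_zero (α := ℝ) (μ := volume)]
  refine lintegral_congr_ae ?_
  have hne' : ∀ᵐ f : ℝ, f ≠ e := by simp [ae_iff]
  filter_upwards [hne'] with f hf
  rw [Set.indicator_of_notMem, mul_zero]
  intro hmem
  have h0 : (sl2Coord (a, e, f)) 0 1 = (sl2Coord (a, e, f)) 1 0 := hmem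
  simp [coe_sl2Coord ha] at h0
  exact hf h0

theorem sl2Haar_eq_two_mul {D : Set SL(2, ℝ)} (hD : MeasurableSet D)
    (hT : ∀ g, Matrix.SpecialLinearGroup.transpose g ∈ D ↔ g ∈ D) :
    sl2Haar D = 2 * sl2Haar (D ∩ {g | g 0 1 < g 1 0}) := by
  have hm := measurableSet_entry_lt 0 1 1 0
  have h1 : Matrix.SpecialLinearGroup.transpose ⁻¹' (D ∩ {g : SL(2, ℝ) | g 0 1 < g 1 0}) =
      D ∩ {g : SL(2, ℝ) | g 1 0 < g 0 1} := by
    ext g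
    exact and_congr (hT g) Iff.rfl
  have h2 : sl2Haar (D ∩ {g : SL(2, ℝ) | g 1 0 < g 0 1}) =
      sl2Haar (D ∩ {g : SL(2, ℝ) | g 0 1 < g 1 0}) := by
    conv_rhs => rw [← map_transpose_sl2Haar]
    rw [Measure.map_apply continuous_sl2_transpose.measurable (hD.inter hm), h1]
  have h3 : sl2Haar (D \ {g : SL(2, ℝ) | g 0 1 < g 1 0}) =
      sl2Haar (D ∩ {g : SL(2, ℝ) | g 1 0 < g 0 1}) := by
    refine measure_congr ?_
    have : ∀ᵐ g ∂sl2Haar, ¬(g 0 1 = g 1 0) := by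
      rw [ae_iff]; simpa using sl2Haar_symmetric_null
    filter_upwards [this] with g hg
    refine propext (and_congr_right fun _ => ?_)
    change ¬(g 0 1 < g 1 0) ↔ g 1 0 < g 0 1
    rw [not_lt]
    exact ⟨fun h => lt_of_le_of_ne h (Ne.symm hg), le_of_lt⟩
  rw [← measure_inter_add_sdiff D hm, h3, h2, two_mul]

/-- The covering radius of the lattice spanned by a reduced basis. -/
def reducedRadius (g : SL(2, ℝ)) : ℝ := g 0 0 + g 1 1 - min (-g 1 0) (-g 0 1)

theorem continuous_reducedRadius : Continuous reducedRadius := by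
  have h : ∀ i j, Continuous fun g : SL(2, ℝ) => g i j := by intro i j; fun_prop
  exact ((h 0 0).add (h 1 1)).sub ((h 1 0).neg.min (h 0 1).neg)

theorem transpose_mem_reducedDomain_iff (g : SL(2, ℝ)) :
    g.transpose ∈ reducedDomain ↔ g ∈ reducedDomain := by
  simp only [reducedDomain, Set.mem_ofPred_eq, Matrix.SpecialLinearGroup.coe_transpose,
    Matrix.transpose_apply]
  tauto

theorem reducedRadius_transpose (g : SL(2, ℝ)) : reducedRadius g.transpose = reducedRadius g := by
  simp only [reducedRadius, Matrix.SpecialLinearGroup.coe_transpose, Matrix.transpose_apply]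
  rw [min_comm]

/-- The values of the first coordinate of a reduced basis with given radius `R` and smallest
off-diagonal entry `e`. -/
def sectionSet (R e : ℝ) : Set ℝ :=
  {a | 0 < a ∧ 1 + e ^ 2 < a * (R + e - a) ∧ a * (R + e - a) < 1 + e * a ∧
    a * (R + e - a) < 1 + e * (R + e - a)}

/-- For $e<f$ the radius is $R=a+b-e$, affine in $f$ because $b=(1+ef)/a$. Substituting $b=R+e-a$
and $ef=ab-1$ turns $e<f$, $f<a$, $f<b$ into the conditions defining the section. -/
theorem sl2Coord_mem_iff {a e : ℝ} (ha : 0 < a) (he : 0 < e) (f R₀ : ℝ) :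
    sl2Coord (a, e, f) ∈ (reducedDomain ∩ {g | R₀ < reducedRadius g}) ∩
      {g : SL(2, ℝ) | g 0 1 < g 1 0} ↔
    R₀ < e / a * f + (a + a⁻¹ - e) ∧ a ∈ sectionSet (e / a * f + (a + a⁻¹ - e)) e := by
  have hb : e / a * f + (a + a⁻¹ - e) + e - a = (1 + e * f) / a := by field_simp; ring
  have hab : a * (e / a * f + (a + a⁻¹ - e) + e - a) = 1 + e * f := by rw [hb]; field_simp
  simp only [Set.mem_inter_iff, reducedDomain, reducedRadius, Set.mem_ofPred_eq, sectionSet,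
    coe_sl2Coord ha.ne', hb]
  simp only [Matrix.of_apply, Matrix.cons_val', Matrix.cons_val_zero, Matrix.cons_val_one,
    Matrix.cons_val_fin_one, neg_neg, neg_lt_neg_iff]
  have hR : e / a * f + (a + a⁻¹ - e) = a + (1 + e * f) / a - e := by linarith
  rw [hR]
  constructor
  · rintro ⟨⟨⟨⟨-, -⟩, ⟨h3, h4⟩, h5, h6⟩, h7⟩, h8⟩
    rw [min_eq_left h8.le] at h7
    refine ⟨h7, ha, ?_, ?_, ?_⟩
    · nlinarith
    · nlinarith
    · nlinarith
  · rintro ⟨h7, -, h1, h2, h3⟩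
    have hef : e < f := by nlinarith
    have hfa : f < a := by nlinarith
    have hfb : f < (1 + e * f) / a := by nlinarith
    refine ⟨⟨⟨⟨he, he.trans hef⟩, ⟨hef.trans hfa, hef.trans hfb⟩, hfa, hfb⟩, ?_⟩, hef⟩
    rwa [min_eq_left hef.le]

theorem lintegral_rotate {K : ℝ × ℝ × ℝ → ENNReal} (hK : Measurable K) :
    ∫⁻ a : ℝ, ∫⁻ e : ℝ, ∫⁻ R : ℝ, K (R, e, a) = ∫⁻ R : ℝ, ∫⁻ e : ℝ, ∫⁻ a : ℝ, K (R, e, a) := by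
  have h1 : ∀ a : ℝ, ∫⁻ e : ℝ, ∫⁻ R : ℝ, K (R, e, a) = ∫⁻ R : ℝ, ∫⁻ e : ℝ, K (R, e, a) := fun a =>
    lintegral_lintegral_swap (Measurable.aemeasurable (by
      change Measurable fun p : ℝ × ℝ => K (p.2, p.1, a)
      exact hK.comp (by fun_prop)))
  simp_rw [h1]
  rw [lintegral_lintegral_swap]
  · refine lintegral_congr fun R => ?_
    refine lintegral_lintegral_swap (Measurable.aemeasurable ?_)
    change Measurable fun p : ℝ × ℝ => K (R, p.2, p.1)
    exact hK.comp (by fun_prop)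
  · refine Measurable.aemeasurable ?_
    have h2 : Measurable fun p : (ℝ × ℝ) × ℝ => K (p.1.2, p.2, p.1.1) := hK.comp (by fun_prop)
    exact h2.lintegral_prod_right'

theorem sl2Haar_reducedRadius_gt (R₀ : ℝ) :
    sl2Haar (reducedDomain ∩ {g | R₀ < reducedRadius g}) =
      2 * ∫⁻ R in Set.Ioi R₀, ∫⁻ e in Set.Ioi (0 : ℝ),
        ENNReal.ofReal e⁻¹ * volume (sectionSet R e) := by
  have hDm : MeasurableSet (reducedDomain ∩ {g | R₀ < reducedRadius g}) :=
    isOpen_reducedDomain.measurableSet.inter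
      (isOpen_lt continuous_const continuous_reducedRadius).measurableSet
  rw [sl2Haar_eq_two_mul hDm fun g => by
    simp only [Set.mem_inter_iff, transpose_mem_reducedDomain_iff, Set.mem_ofPred_eq,
      reducedRadius_transpose]]
  congr 1
  set B := (reducedDomain ∩ {g | R₀ < reducedRadius g}) ∩ {g : SL(2, ℝ) | g 0 1 < g 1 0} with hB
  have hBm : MeasurableSet B := hDm.inter (measurableSet_entry_lt 0 1 1 0)
  let W : Set (ℝ × ℝ × ℝ) := {p | R₀ < p.1 ∧ 0 < p.2.1 ∧ p.2.2 ∈ sectionSet p.1 p.2.1}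
  have hW : MeasurableSet W := by
    refine IsOpen.measurableSet ?_
    exact (isOpen_lt (f := fun p : ℝ × ℝ × ℝ => R₀) (g := fun p => p.1)
        (by fun_prop) (by fun_prop)).inter
      ((isOpen_lt (f := fun p : ℝ × ℝ × ℝ => (0 : ℝ)) (g := fun p => p.2.1)
        (by fun_prop) (by fun_prop)).inter
      ((isOpen_lt (f := fun p : ℝ × ℝ × ℝ => (0 : ℝ)) (g := fun p => p.2.2)
        (by fun_prop) (by fun_prop)).inter
      ((isOpen_lt (f := fun p : ℝ × ℝ × ℝ => 1 + p.2.1 ^ 2)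
        (g := fun p => p.2.2 * (p.1 + p.2.1 - p.2.2)) (by fun_prop) (by fun_prop)).inter
      ((isOpen_lt (f := fun p : ℝ × ℝ × ℝ => p.2.2 * (p.1 + p.2.1 - p.2.2))
        (g := fun p => 1 + p.2.1 * p.2.2) (by fun_prop) (by fun_prop)).inter
      (isOpen_lt (f := fun p : ℝ × ℝ × ℝ => p.2.2 * (p.1 + p.2.1 - p.2.2))
        (g := fun p => 1 + p.2.1 * (p.1 + p.2.1 - p.2.2)) (by fun_prop) (by fun_prop))))))
  let K : ℝ × ℝ × ℝ → ENNReal := fun p => ENNReal.ofReal p.2.1⁻¹ * W.indicator 1 p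
  have hK : Measurable K := Measurable.mul (by fun_prop) (measurable_one.indicator hW)
  have hne : ∀ᵐ a : ℝ, a ≠ 0 := by simp [ae_iff]
  have step : sl2Haar B = ∫⁻ a : ℝ, ∫⁻ e : ℝ, ∫⁻ R : ℝ, K (R, e, a) := by
    rw [← lintegral_indicator_one hBm, lintegral_sl2Haar (measurable_one.indicator hBm)]
    refine lintegral_congr_ae ?_
    filter_upwards [hne] with a ha
    refine lintegral_congr fun e => ?_
    by_cases hpos : 0 < a ∧ 0 < e
    · obtain ⟨ha0, he0⟩ := hpos
      have h1 : ∀ f, B.indicator (1 : SL(2, ℝ) → ENNReal) (sl2Coord (a, e, f)) =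
          (fun R => W.indicator (1 : ℝ × ℝ × ℝ → ENNReal) (R, e, a))
            (e / a * f + (a + a⁻¹ - e)) := by
        intro f
        have h := sl2Coord_mem_iff ha0 he0 f R₀
        by_cases hf : sl2Coord (a, e, f) ∈ B
        · have hw : (e / a * f + (a + a⁻¹ - e), e, a) ∈ W := ⟨(h.1 hf).1, he0, (h.1 hf).2⟩
          simp only [Set.indicator_of_mem hf, Set.indicator_of_mem hw, Pi.one_apply]
        · have hw : (e / a * f + (a + a⁻¹ - e), e, a) ∉ W := fun hw => hf (h.2 ⟨hw.1, hw.2.2⟩)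
          simp only [Set.indicator_of_notMem hf, Set.indicator_of_notMem hw]
      simp_rw [h1]
      simp only [K]
      -- The Jacobian $a/e$ of $f\mapsto R$ cancels the Haar weight $1/a$ and leaves $1/e$.
      rw [lintegral_const_mul' _ _ ENNReal.ofReal_ne_top,
        lintegral_comp_affine (F := fun R => W.indicator (1 : ℝ × ℝ × ℝ → ENNReal) (R, e, a))
        (div_pos he0 ha0).ne', lintegral_const_mul' _ _ ENNReal.ofReal_ne_top, ← mul_assoc,
        ← ENNReal.ofReal_mul (by positivity), abs_of_pos ha0, abs_of_pos (by positivity)]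
      congr 2
      field_simp
    · have h1 : ∀ f, B.indicator (1 : SL(2, ℝ) → ENNReal) (sl2Coord (a, e, f)) = 0 := by
        intro f
        refine Set.indicator_of_notMem ?_ _
        rintro ⟨⟨⟨⟨h2, -⟩, ⟨h3, -⟩, -⟩, -⟩, -⟩
        simp only [coe_sl2Coord ha, Matrix.of_apply, Matrix.cons_val', Matrix.cons_val_zero,
          Matrix.cons_val_one, Matrix.cons_val_fin_one, neg_neg] at h2 h3
        exact hpos ⟨h2.trans h3, h2⟩
      have h2 : ∀ R, K (R, e, a) = 0 := by
        intro R
        simp only [K]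
        rw [Set.indicator_of_notMem, mul_zero]
        rintro ⟨-, he, hs⟩
        exact hpos ⟨hs.1, he⟩
      simp [h1, h2]
  rw [step, lintegral_rotate hK, ← lintegral_indicator measurableSet_Ioi]
  refine lintegral_congr fun R => ?_
  by_cases hR : R ∈ Set.Ioi R₀
  · rw [Set.indicator_of_mem hR, ← lintegral_indicator measurableSet_Ioi]
    refine lintegral_congr fun e => ?_
    by_cases he : e ∈ Set.Ioi (0 : ℝ)
    · rw [Set.indicator_of_mem he]
      simp only [K]
      rw [lintegral_const_mul' _ _ ENNReal.ofReal_ne_top]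
      congr 1
      have hS : MeasurableSet (sectionSet R e) :=
        (hW.preimage (show Measurable fun a : ℝ => (R, e, a) by fun_prop)).congr (by
          ext a
          exact ⟨fun h => h.2.2, fun h => ⟨hR, he, h⟩⟩)
      rw [← lintegral_indicator_one hS]
      refine lintegral_congr fun a => ?_
      by_cases ha : a ∈ sectionSet R e
      · rw [Set.indicator_of_mem ha, Set.indicator_of_mem (show (R, e, a) ∈ W from ⟨hR, he, ha⟩)]
        rfl
      · rw [Set.indicator_of_notMem ha, Set.indicator_of_notMem fun h => ha h.2.2]
    · rw [Set.indicator_of_notMem he]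
      have : ∀ a, K (R, e, a) = 0 := by
        intro a
        simp only [K]
        rw [Set.indicator_of_notMem (fun h => he h.2.1), mul_zero]
      simp [this]
  · rw [Set.indicator_of_notMem hR]
    have : ∀ e a, K (R, e, a) = 0 := by
      intro e a
      simp only [K]
      rw [Set.indicator_of_notMem (fun h => hR h.1), mul_zero]
    simp [this]

/-! ### Length of the sections -/

/-- Put $\tau=2a-(R+e)=a-b$, so that $4ab=(R+e)^2-\tau^2$, and complete squares. -/
theorem mem_sectionSet_iff {R e : ℝ} (he : 0 < e) (a : ℝ) :
    a ∈ sectionSet R e ↔ (2 * a + -(R + e)) ^ 2 < sectionQuad R e ∧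
      R ^ 2 - 4 < ((2 * a + -(R + e)) - e) ^ 2 ∧ R ^ 2 - 4 < ((2 * a + -(R + e)) + e) ^ 2 := by
  simp only [sectionSet, Set.mem_ofPred_eq, sectionQuad]
  constructor
  · rintro ⟨h1, h2, h3, h4⟩
    refine ⟨by nlinarith, by nlinarith, by nlinarith⟩
  · rintro ⟨h1, h2, h3⟩
    have h4 : 1 + e ^ 2 < a * (R + e - a) := by nlinarith
    refine ⟨?_, h4, by nlinarith, by nlinarith⟩
    by_contra ha
    push Not at ha
    nlinarith [sq_nonneg e]

theorem volume_preimage_two_mul_add {S : Set ℝ} (hS : MeasurableSet S) (l : ℝ) :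
    volume {a : ℝ | 2 * a + l ∈ S} = ENNReal.ofReal 2⁻¹ * volume S := by
  have hS' : MeasurableSet {a : ℝ | 2 * a + l ∈ S} :=
    hS.preimage (show Measurable fun a : ℝ => 2 * a + l by fun_prop)
  rw [← lintegral_indicator_one hS, ← lintegral_indicator_one hS']
  have h := lintegral_comp_affine (F := S.indicator 1) (two_ne_zero (α := ℝ)) l
  rw [abs_of_pos (by norm_num)] at h
  exact h

theorem sq_lt_iff_mem_Ioo_sqrt (τ q : ℝ) : τ ^ 2 < q ↔ τ ∈ Set.Ioo (-√q) √q := by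
  rw [← sq_abs, ← Real.lt_sqrt (abs_nonneg τ), abs_lt]
  rfl

theorem volume_sectionSet_small {R e : ℝ} (hR : 0 ≤ R) (hR2 : R < 2) (he : 0 < e) :
    volume (sectionSet R e) = ENNReal.ofReal √(sectionQuad R e) := by
  have h : sectionSet R e =
      {a | 2 * a + -(R + e) ∈ Set.Ioo (-√(sectionQuad R e)) √(sectionQuad R e)} := by
    ext a
    rw [mem_sectionSet_iff he, Set.mem_ofPred_eq, ← sq_lt_iff_mem_Ioo_sqrt]
    refine and_iff_left ⟨?_, ?_⟩
    · nlinarith [sq_nonneg ((2 * a + -(R + e)) - e)]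
    · nlinarith [sq_nonneg ((2 * a + -(R + e)) + e)]
  rw [h, volume_preimage_two_mul_add measurableSet_Ioo, Real.volume_Ioo,
    ← ENNReal.ofReal_mul (by norm_num)]
  congr 1
  ring

/-- The conditions are $|\tau|<w$ and $|\tau\pm e|>s$. They leave two outer intervals $e+s<|\tau|<w$
and, when $e>s$, a central one $|\tau|<\min(w,e-s)$. Lengths in $\tau$ are halved since
$d\tau=2\,da$. -/
theorem volume_sectionSet_large {R e s : ℝ} (hs : 0 < s) (hsR : s ^ 2 = R ^ 2 - 4)
    (he : 0 < e) :
    volume (sectionSet R e) = ENNReal.ofReal (√(sectionQuad R e) - e - s) +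
      ENNReal.ofReal (min √(sectionQuad R e) (e - s)) := by
  set w := √(sectionQuad R e) with hw
  set m := min w (e - s) with hm
  have hmw : m ≤ w := min_le_left _ _
  have hme : m ≤ e - s := min_le_right _ _
  have hw0 : 0 ≤ w := Real.sqrt_nonneg _
  have h : sectionSet R e =
      {a | 2 * a + -(R + e) ∈ (Set.Ioo (e + s) w ∪ Set.Ioo (-w) (-(e + s))) ∪ Set.Ioo (-m) m} := by
    ext a
    rw [mem_sectionSet_iff he, Set.mem_ofPred_eq, sq_lt_iff_mem_Ioo_sqrt, ← hsR]
    set τ := 2 * a + -(R + e)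
    simp only [Set.mem_union, Set.mem_Ioo]
    constructor
    · rintro ⟨⟨h1, h2⟩, h3, h4⟩
      rcases le_or_gt 0 τ with h0 | h0
      · rcases lt_abs.1 (show s < |τ - e| from
            lt_of_pow_lt_pow_left₀ 2 (abs_nonneg _) (by rwa [sq_abs])) with h | h
        · exact Or.inl (Or.inl ⟨by linarith, h2⟩)
        · have hτm : τ < m := lt_min h2 (by linarith)
          exact Or.inr ⟨by linarith, hτm⟩
      · rcases lt_abs.1 (show s < |τ + e| from
            lt_of_pow_lt_pow_left₀ 2 (abs_nonneg _) (by rwa [sq_abs])) with h | h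
        · have hτm : -τ < m := lt_min (by linarith) (by linarith)
          exact Or.inr ⟨by linarith, by linarith⟩
        · exact Or.inl (Or.inr ⟨h1, by linarith⟩)
    · rintro ((⟨h1, h2⟩ | ⟨h1, h2⟩) | ⟨h1, h2⟩)
      · refine ⟨⟨by linarith, h2⟩, ?_, ?_⟩ <;> nlinarith
      · refine ⟨⟨h1, by linarith⟩, ?_, ?_⟩ <;> nlinarith
      · refine ⟨⟨by linarith, by linarith⟩, ?_, ?_⟩ <;> nlinarith
  rw [h, volume_preimage_two_mul_add ((measurableSet_Ioo.union measurableSet_Ioo).union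
    measurableSet_Ioo), measure_union _ measurableSet_Ioo, measure_union _ measurableSet_Ioo,
    Real.volume_Ioo, Real.volume_Ioo, Real.volume_Ioo, mul_add, mul_add,
    ← ENNReal.ofReal_mul (by norm_num), ← ENNReal.ofReal_mul (by norm_num),
    ← ENNReal.ofReal_mul (by norm_num)]
  · congr 1
    · have h1 : (2 : ℝ)⁻¹ * (w - (e + s)) = 2⁻¹ * (w - e - s) := by ring
      have h2 : (2 : ℝ)⁻¹ * (-(e + s) - -w) = 2⁻¹ * (w - e - s) := by ring
      rw [h1, h2, ENNReal.ofReal_mul (by norm_num), ← add_mul, ← ENNReal.ofReal_add (by norm_num)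
        (by norm_num)]
      norm_num
    · congr 1
      ring
  · exact Set.disjoint_left.2 fun x hx hx' => by linarith [hx.1, hx'.2]
  · refine Set.disjoint_left.2 fun x hx hx' => ?_
    rcases hx with hx | hx
    · linarith [hx.1, hx'.2]
    · linarith [hx.2, hx'.1]

theorem lintegral_volume_sectionSet {R : ℝ} (hR : 0 ≤ R) (hR2 : R ≠ 2) :
    ∫⁻ e in Set.Ioi (0 : ℝ), ENNReal.ofReal e⁻¹ * volume (sectionSet R e) =
      ENNReal.ofReal (Real.pi ^ 2 / 12 * ustinovDensity R) := by
  have hpi := Real.pi_pos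
  rcases lt_or_gt_of_ne hR2 with h2 | h2
  · have h1 : ∫⁻ e in Set.Ioi (0 : ℝ), ENNReal.ofReal e⁻¹ * volume (sectionSet R e) =
        ∫⁻ e in Set.Ioi (0 : ℝ), ENNReal.ofReal (√(sectionQuad R e) / e) := by
      refine setLIntegral_congr_fun measurableSet_Ioi fun e he => ?_
      have he0 : (0 : ℝ) < e := he
      rw [volume_sectionSet_small hR h2 he, ← ENNReal.ofReal_mul (by positivity)]
      congr 1
      ring
    rw [h1]
    rcases le_or_gt R √3 with h3 | h3
    · rw [lintegral_section_small hR h3, ustinovDensity, if_pos h3]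
      simp
    · rw [lintegral_section_mid h3 h2, ustinovDensity, if_neg (not_le.2 h3), if_pos h2.le]
      congr 1
      field_simp
  · have hRsq : 4 < R ^ 2 := by nlinarith
    have hR0 : 0 < R := by linarith
    have hs : 0 < √(R ^ 2 - 4) := Real.sqrt_pos.2 (by linarith)
    have hs2 : √(R ^ 2 - 4) ^ 2 = R ^ 2 - 4 := Real.sq_sqrt (by linarith)
    have hρ : 0 < √(R ^ 2 - 3) := Real.sqrt_pos.2 (by linarith)
    have hρ2 : √(R ^ 2 - 3) ^ 2 = R ^ 2 - 3 := Real.sq_sqrt (by linarith)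
    have h3 : ¬ R ≤ √3 := by
      rw [not_le]
      exact (Real.sqrt_lt' hR0).2 (by linarith)
    have h1 : ∫⁻ e in Set.Ioi (0 : ℝ), ENNReal.ofReal e⁻¹ * volume (sectionSet R e) =
        ∫⁻ e in Set.Ioi (0 : ℝ), (ENNReal.ofReal ((√(sectionQuad R e) - e - √(R ^ 2 - 4)) / e) +
          ENNReal.ofReal (min (√(sectionQuad R e)) (e - √(R ^ 2 - 4)) / e)) := by
      refine setLIntegral_congr_fun measurableSet_Ioi fun e he => ?_
      have he0 : (0 : ℝ) < e := he
      rw [volume_sectionSet_large hs hs2 he, mul_add, ← ENNReal.ofReal_mul (by positivity),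
        ← ENNReal.ofReal_mul (by positivity)]
      congr 2 <;> ring
    rw [h1, (lintegral_section_large hs hR0 hρ hs2 hρ2).2, ustinovDensity, if_neg h3,
      if_neg (not_le.2 h2), hs2, hρ2]
    congr 1
    field_simp

theorem ustinovDensity_nonneg (R : ℝ) : 0 ≤ ustinovDensity R := by
  have hpi := Real.pi_pos
  have h30 : 0 < √(3 : ℝ) := Real.sqrt_pos.2 (by norm_num)
  have h3' : √(3 : ℝ) ^ 2 = 3 := Real.sq_sqrt (by norm_num)
  rw [ustinovDensity]
  split_ifs with h3 h2
  · exact le_rfl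
  · push Not at h3
    refine mul_nonneg (by positivity) (sub_nonneg.2 (Real.sqrt_le_iff.2 ⟨?_, ?_⟩))
    · have := h30.trans h3
      positivity
    · rw [div_pow, h3']
      nlinarith
  · push Not at h2
    have hRsq : 4 < R ^ 2 := by nlinarith
    have hR0 : 0 < R := by linarith
    have h := (lintegral_section_large (Real.sqrt_pos.2 (by linarith : 0 < R ^ 2 - 4)) hR0
      (Real.sqrt_pos.2 (by linarith : 0 < R ^ 2 - 3)) (Real.sq_sqrt (by linarith))
      (Real.sq_sqrt (by linarith))).1
    rw [Real.sq_sqrt (by linarith), Real.sq_sqrt (by linarith)] at h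
    exact mul_nonneg (by positivity) h

theorem sl2Haar_reducedRadius_gt_eq {R₀ : ℝ} (hR₀ : 0 ≤ R₀) :
    sl2Haar (reducedDomain ∩ {g | R₀ < reducedRadius g}) =
      ENNReal.ofReal (Real.pi ^ 2 / 6) * ∫⁻ R in Set.Ioi R₀, ENNReal.ofReal (ustinovDensity R) := by
  rw [sl2Haar_reducedRadius_gt]
  have h : ∫⁻ R in Set.Ioi R₀, ∫⁻ e in Set.Ioi (0 : ℝ),
        ENNReal.ofReal e⁻¹ * volume (sectionSet R e) =
      ∫⁻ R in Set.Ioi R₀, ENNReal.ofReal (Real.pi ^ 2 / 12) * ENNReal.ofReal (ustinovDensity R) := by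
    refine lintegral_congr_ae ?_
    have hne : ∀ᵐ R ∂(volume.restrict (Set.Ioi R₀)), R ≠ (2 : ℝ) :=
      ae_restrict_of_ae (by simp [ae_iff])
    filter_upwards [ae_restrict_mem measurableSet_Ioi, hne] with R hR hR2
    rw [lintegral_volume_sectionSet (hR₀.trans (le_of_lt hR)) hR2, ENNReal.ofReal_mul (by positivity)]
  rw [h, lintegral_const_mul' _ _ ENNReal.ofReal_ne_top, ← mul_assoc]
  congr 1
  rw [← ENNReal.ofReal_ofNat 2, ← ENNReal.ofReal_mul (by norm_num)]
  congr 1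
  ring

/-! ### The volume of the reduced domain -/

theorem lintegral_neg_log_one_sub_div :
    ∫⁻ t in Set.Ioo (0 : ℝ) 1, ENNReal.ofReal (-Real.log (1 - t) / t) =
      ENNReal.ofReal (Real.pi ^ 2 / 6) := by
  have h1 : ∫⁻ t in Set.Ioo (0 : ℝ) 1, ENNReal.ofReal (-Real.log (1 - t) / t) =
      ∫⁻ t in Set.Ioo (0 : ℝ) 1, ∑' n : ℕ, ENNReal.ofReal (t ^ n / (n + 1)) := by
    refine setLIntegral_congr_fun measurableSet_Ioo fun t ht => ?_
    have ht0 : 0 < t := ht.1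
    have hs := Real.hasSum_pow_div_log_of_abs_lt_one (abs_lt.2 ⟨by linarith, ht.2⟩)
    have hs' : HasSum (fun n : ℕ => t ^ n / ((n : ℝ) + 1)) (-Real.log (1 - t) / t) := by
      refine (hs.div_const t).congr_fun fun n => ?_
      field_simp
      ring
    rw [← hs'.tsum_eq, ENNReal.ofReal_tsum_of_nonneg (fun n => by positivity) hs'.summable]
  have h2 : ∀ n : ℕ, ∫⁻ t in Set.Ioo (0 : ℝ) 1, ENNReal.ofReal (t ^ n / (n + 1)) =
      ENNReal.ofReal (1 / ((n : ℝ) + 1) ^ 2) := by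
    intro n
    have := setLIntegral_Ioo_deriv (F := fun t : ℝ => t ^ (n + 1) / ((n : ℝ) + 1) ^ 2)
      (F' := fun t => t ^ n / (n + 1)) (zero_le_one (α := ℝ)) (by fun_prop) (fun t ht => by
        refine ((hasDerivAt_pow (n + 1) t).div_const _).congr_deriv ?_
        push_cast
        field_simp) (fun t ht => by
        have := ht.1
        positivity)
    rw [this]
    simp
  rw [h1, lintegral_tsum fun n => by fun_prop]
  simp_rw [h2]
  have h3 : HasSum (fun n : ℕ => 1 / ((n : ℝ) + 1) ^ 2) (Real.pi ^ 2 / 6) := by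
    have := (hasSum_nat_add_iff' 1).2 hasSum_zeta_two
    simpa using this
  rw [← ENNReal.ofReal_tsum_of_nonneg (fun n => by positivity) h3.summable, h3.tsum_eq]

/-- Here $t$ stands for $e/f$. The logarithm is positive exactly for $f<c=(1-t)^{-1/2}$, and there
an elementary primitive exists. -/
theorem lintegral_mul_log_section {t : ℝ} (ht : t ∈ Set.Ioo (0 : ℝ) 1) :
    ∫⁻ f in Set.Ioi (0 : ℝ), ENNReal.ofReal (f * Real.log ((1 + t * f ^ 2) / f ^ 2)) =
      ENNReal.ofReal (1 / 2 * (-Real.log (1 - t) / t)) := by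
  have ht0 : 0 < t := ht.1
  have ht1 : 0 < 1 - t := sub_pos.2 ht.2
  obtain ⟨c, hc0, hc⟩ : ∃ c : ℝ, 0 < c ∧ c ^ 2 = (1 - t)⁻¹ :=
    ⟨√(1 - t)⁻¹, Real.sqrt_pos.2 (inv_pos.2 ht1), Real.sq_sqrt (inv_pos.2 ht1).le⟩
  have hlog : ∀ f : ℝ, 0 < f → Real.log ((1 + t * f ^ 2) / f ^ 2) =
      Real.log (1 + t * f ^ 2) - 2 * Real.log f := by
    intro f hf
    rw [Real.log_div (by positivity) (by positivity), Real.log_pow]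
    push_cast; rfl
  have hc1 : 1 + t * c ^ 2 = c ^ 2 := by rw [hc]; field_simp; ring
  have hle : ∀ f : ℝ, 0 < f → (1 ≤ (1 + t * f ^ 2) / f ^ 2 ↔ f ≤ c) := by
    intro f hf
    rw [one_le_div (by positivity)]
    have h1 : f ≤ c ↔ f ^ 2 ≤ c ^ 2 := (pow_le_pow_iff_left₀ hf.le hc0.le two_ne_zero).symm
    rw [h1, hc, le_inv_comm₀ (by positivity) ht1, le_inv_comm₀ ht1 (by positivity),
      ← one_div, le_div_iff₀ ht1]
    constructor <;> intro h <;> linarith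
  rw [setLIntegral_eq_of_subset (s := Set.Ioo 0 c) measurableSet_Ioi measurableSet_Ioo
    (fun f hf => hf.1)]
  · have key := setLIntegral_Ioo_deriv (a := 0) (b := c)
      -- The term $f^2\log f$ is grouped as $f\cdot(f\log f)$ so that continuity at $0$ is that of
      -- $f\log f$.
      (F := fun f => 1 / 2 * (f ^ 2 + 1 / t) * Real.log (1 + t * f ^ 2) - f * (f * Real.log f))
      (F' := fun f => f * Real.log ((1 + t * f ^ 2) / f ^ 2)) hc0.le ?_ ?_ ?_
    · rw [key]
      congr 1
      have h1 : Real.log (c ^ 2) = 2 * Real.log c := by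
        rw [Real.log_pow]; push_cast; rfl
      have h2 : -Real.log (1 - t) = 2 * Real.log c := by
        rw [← h1, hc, Real.log_inv]
      rw [hc1, h1, h2]
      simp
      ring
    · refine ContinuousOn.sub (ContinuousOn.mul (by fun_prop) (ContinuousOn.log (by fun_prop) ?_))
        (continuousOn_id.mul Real.continuous_mul_log.continuousOn)
      intro f hf
      positivity
    · intro f hf
      have hf0 : 0 < f := hf.1
      have hN : 0 < 1 + t * f ^ 2 := by positivity
      have d1 : HasDerivAt (fun f : ℝ => 1 / 2 * (f ^ 2 + 1 / t)) f f := by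
        refine ((((hasDerivAt_id' f).pow 2).add_const (1 / t)).const_mul (1 / 2)).congr_deriv ?_
        push_cast; ring
      have d2 : HasDerivAt (fun f : ℝ => Real.log (1 + t * f ^ 2)) (2 * t * f / (1 + t * f ^ 2)) f := by
        have := ((((hasDerivAt_id' f).pow 2).const_mul t).const_add 1).log hN.ne'
        refine this.congr_deriv ?_
        push_cast
        congr 1
        ring
      have d3 := (hasDerivAt_id' f).mul (Real.hasDerivAt_mul_log hf0.ne')
      refine ((d1.mul d2).sub d3).congr_deriv ?_
      rw [hlog f hf0]
      field_simp
      ring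
    · intro f hf
      have hf0 : 0 < f := hf.1
      exact mul_nonneg hf0.le (Real.log_nonneg ((hle f hf0).2 hf.2.le))
  · rintro f ⟨h0, h1⟩
    have h0' : (0 : ℝ) < f := h0
    have h1' : c ≤ f := not_lt.1 fun h => h1 ⟨h0, h⟩
    refine ENNReal.ofReal_of_nonpos (mul_nonpos_of_nonneg_of_nonpos h0'.le
      (Real.log_nonpos (by positivity) ?_))
    by_contra hc'
    push Not at hc'
    rcases eq_or_lt_of_le h1' with h | h
    · rw [← h, hc1, div_self (by positivity)] at hc'
      exact lt_irrefl _ hc'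
    · exact absurd ((hle f h0').1 hc'.le) (not_le.2 h)

theorem lintegral_inv_Ioo {x y : ℝ} (hx : 0 < x) (hy : 0 < y) :
    ∫⁻ a in Set.Ioo x y, ENNReal.ofReal a⁻¹ = ENNReal.ofReal (Real.log (y / x)) := by
  rcases le_or_gt x y with h | h
  · rw [setLIntegral_Ioo_deriv (F := Real.log) h, Real.log_div hy.ne' hx.ne']
    · exact Real.continuousOn_log.mono fun a ha => (hx.trans_le ha.1).ne'
    · exact fun a ha => Real.hasDerivAt_log (hx.trans ha.1).ne'
    · exact fun a ha => inv_nonneg.2 (hx.trans ha.1).le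
  · rw [Set.Ioo_eq_empty (not_lt.2 h.le), Measure.restrict_empty, lintegral_zero_measure,
      ENNReal.ofReal_of_nonpos]
    exact Real.log_nonpos (by positivity) ((div_le_one hx).2 h.le)

theorem lintegral_Ioo_scale {F : ℝ → ENNReal} {f : ℝ} (hf : 0 < f) :
    ∫⁻ e in Set.Ioo 0 f, F e = ENNReal.ofReal f * ∫⁻ t in Set.Ioo (0 : ℝ) 1, F (f * t) := by
  rw [← lintegral_indicator measurableSet_Ioo, ← lintegral_indicator measurableSet_Ioo]
  have h := lintegral_comp_affine (F := (Set.Ioo 0 f).indicator F) hf.ne' 0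
  have h2 : ∀ t, (Set.Ioo 0 f).indicator F (f * t + 0) =
      (Set.Ioo (0 : ℝ) 1).indicator (fun t => F (f * t)) t := by
    intro t
    rw [add_zero]
    have hiff : f * t ∈ Set.Ioo 0 f ↔ t ∈ Set.Ioo (0 : ℝ) 1 := by
      simp only [Set.mem_Ioo]
      refine and_congr (mul_pos_iff_of_pos_left hf) ?_
      exact mul_lt_iff_lt_one_right hf
    by_cases ht : t ∈ Set.Ioo (0 : ℝ) 1
    · rw [Set.indicator_of_mem ht, Set.indicator_of_mem (hiff.2 ht)]
    · rw [Set.indicator_of_notMem ht, Set.indicator_of_notMem fun h => ht (hiff.1 h)]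
  simp_rw [h2] at h
  rw [h, ← mul_assoc, ← ENNReal.ofReal_mul hf.le, abs_of_pos (inv_pos.2 hf), mul_inv_cancel₀ hf.ne',
    ENNReal.ofReal_one, one_mul]

/-- On the half $e<f$ the domain is $0<e<f<a<(1+ef)/f$. Integrating $da/a$ gives a logarithm; after
$e=tf$ the integral over $f$ is elementary, and the one over $t$ is the dilogarithm at $1$. -/
theorem sl2Haar_reducedDomain : sl2Haar reducedDomain = ENNReal.ofReal (Real.pi ^ 2 / 6) := by
  rw [sl2Haar_eq_two_mul isOpen_reducedDomain.measurableSet transpose_mem_reducedDomain_iff]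
  set B := reducedDomain ∩ {g : SL(2, ℝ) | g 0 1 < g 1 0} with hB
  have hBm : MeasurableSet B :=
    isOpen_reducedDomain.measurableSet.inter (measurableSet_entry_lt 0 1 1 0)
  let W : Set (ℝ × ℝ × ℝ) :=
    {p | 0 < p.2.1 ∧ p.2.1 < p.1 ∧ p.1 < p.2.2 ∧ p.2.2 * p.1 < 1 + p.2.1 * p.1}
  have hW : MeasurableSet W := by
    refine IsOpen.measurableSet ?_
    exact (isOpen_lt (f := fun p : ℝ × ℝ × ℝ => (0 : ℝ)) (g := fun p => p.2.1)
        (by fun_prop) (by fun_prop)).inter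
      ((isOpen_lt (f := fun p : ℝ × ℝ × ℝ => p.2.1) (g := fun p => p.1)
        (by fun_prop) (by fun_prop)).inter
      ((isOpen_lt (f := fun p : ℝ × ℝ × ℝ => p.1) (g := fun p => p.2.2)
        (by fun_prop) (by fun_prop)).inter
      (isOpen_lt (f := fun p : ℝ × ℝ × ℝ => p.2.2 * p.1)
        (g := fun p => 1 + p.2.1 * p.1) (by fun_prop) (by fun_prop))))
  let K : ℝ × ℝ × ℝ → ENNReal := fun p => ENNReal.ofReal |p.2.2|⁻¹ * W.indicator 1 p
  have hK : Measurable K := Measurable.mul (by fun_prop) (measurable_one.indicator hW)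
  have hne : ∀ᵐ a : ℝ, a ≠ 0 := by simp [ae_iff]
  have step : sl2Haar B = ∫⁻ a : ℝ, ∫⁻ e : ℝ, ∫⁻ f : ℝ, K (f, e, a) := by
    rw [← lintegral_indicator_one hBm, lintegral_sl2Haar (measurable_one.indicator hBm)]
    refine lintegral_congr_ae ?_
    filter_upwards [hne] with a ha
    refine lintegral_congr fun e => lintegral_congr fun f => ?_
    have h : sl2Coord (a, e, f) ∈ B ↔ (f, e, a) ∈ W := by
      simp only [B, W, Set.mem_inter_iff, reducedDomain, Set.mem_ofPred_eq, coe_sl2Coord ha,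
        Matrix.of_apply, Matrix.cons_val', Matrix.cons_val_zero, Matrix.cons_val_one,
        Matrix.cons_val_fin_one, neg_neg, neg_lt_neg_iff]
      constructor
      · rintro ⟨⟨⟨h1, h2⟩, ⟨h3, h4⟩, h5, h6⟩, h7⟩
        refine ⟨h1, h7, h5, ?_⟩
        have ha0 : 0 < a := h1.trans h3
        rw [lt_div_iff₀ ha0] at h6
        linarith
      · rintro ⟨h1, h2, h3, h4⟩
        have ha0 : 0 < a := (h1.trans h2).trans h3
        have h6 : f < (1 + e * f) / a := by rw [lt_div_iff₀ ha0]; linarith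
        exact ⟨⟨⟨h1, h1.trans h2⟩, ⟨h2.trans h3, h2.trans h6⟩, h3, h6⟩, h2⟩
    simp only [K]
    congr 1
    by_cases hf : sl2Coord (a, e, f) ∈ B
    · rw [Set.indicator_of_mem hf, Set.indicator_of_mem (h.1 hf)]; rfl
    · rw [Set.indicator_of_notMem hf, Set.indicator_of_notMem fun hw => hf (h.2 hw)]
  have inner : ∀ f e : ℝ, 0 < f → e ∈ Set.Ioo 0 f → ∫⁻ a : ℝ, K (f, e, a) =
      ENNReal.ofReal (Real.log ((1 + e * f) / f ^ 2)) := by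
    intro f e hf he
    have he0 : 0 < e := he.1
    have h1 : ∀ a, K (f, e, a) =
        (Set.Ioo f ((1 + e * f) / f)).indicator (fun a => ENNReal.ofReal a⁻¹) a := by
      intro a
      have h : (f, e, a) ∈ W ↔ a ∈ Set.Ioo f ((1 + e * f) / f) := by
        rw [Set.mem_Ioo, lt_div_iff₀ hf]
        exact ⟨fun h => ⟨h.2.2.1, h.2.2.2⟩, fun h => ⟨he.1, he.2, h.1, h.2⟩⟩
      simp only [K]
      by_cases ha : a ∈ Set.Ioo f ((1 + e * f) / f)
      · rw [Set.indicator_of_mem ha, Set.indicator_of_mem (h.2 ha), abs_of_pos (hf.trans ha.1)]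
        simp
      · rw [Set.indicator_of_notMem ha, Set.indicator_of_notMem fun hw => ha (h.1 hw), mul_zero]
    simp_rw [h1]
    rw [lintegral_indicator measurableSet_Ioo, lintegral_inv_Ioo hf (by positivity)]
    congr 2
    field_simp
  have middle : ∀ f : ℝ, ∫⁻ e : ℝ, ∫⁻ a : ℝ, K (f, e, a) =
      (Set.Ioi (0 : ℝ)).indicator (fun f => ∫⁻ t in Set.Ioo (0 : ℝ) 1,
        ENNReal.ofReal (f * Real.log ((1 + t * f ^ 2) / f ^ 2))) f := by
    intro f
    have h1 : ∫⁻ e : ℝ, ∫⁻ a : ℝ, K (f, e, a) = ∫⁻ e in Set.Ioo 0 f, ∫⁻ a : ℝ, K (f, e, a) := by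
      rw [← lintegral_indicator measurableSet_Ioo]
      refine lintegral_congr fun e => ?_
      by_cases he : e ∈ Set.Ioo 0 f
      · rw [Set.indicator_of_mem he]
      · rw [Set.indicator_of_notMem he]
        have : ∀ a, K (f, e, a) = 0 := by
          intro a
          simp only [K]
          rw [Set.indicator_of_notMem (fun h => he ⟨h.1, h.2.1⟩), mul_zero]
        simp [this]
    rw [h1]
    by_cases hf : f ∈ Set.Ioi (0 : ℝ)
    · have hf0 : 0 < f := hf
      rw [Set.indicator_of_mem hf, setLIntegral_congr_fun measurableSet_Ioo fun e he =>
        inner f e hf he, lintegral_Ioo_scale hf, ← lintegral_const_mul' _ _ ENNReal.ofReal_ne_top]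
      refine lintegral_congr fun t => ?_
      rw [← ENNReal.ofReal_mul hf0.le]
      congr 5
      ring
    · rw [Set.indicator_of_notMem hf, Set.Ioo_eq_empty (not_lt.2 (not_lt.1 hf))]
      simp
  rw [step, lintegral_rotate hK]
  simp_rw [middle]
  rw [lintegral_indicator measurableSet_Ioi, lintegral_lintegral_swap]
  · rw [setLIntegral_congr_fun measurableSet_Ioo fun t ht => lintegral_mul_log_section ht]
    have h1 : ∀ t : ℝ, ENNReal.ofReal (1 / 2 * (-Real.log (1 - t) / t)) =
        ENNReal.ofReal (1 / 2) * ENNReal.ofReal (-Real.log (1 - t) / t) := fun t =>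
      ENNReal.ofReal_mul (by norm_num)
    simp_rw [h1]
    rw [lintegral_const_mul' _ _ ENNReal.ofReal_ne_top, lintegral_neg_log_one_sub_div, ← mul_assoc,
      ← ENNReal.ofReal_ofNat 2, ← ENNReal.ofReal_mul (by norm_num)]
    norm_num
  · refine Measurable.aemeasurable ?_
    have h1 : Measurable fun p : ℝ × ℝ =>
        p.1 * Real.log ((1 + p.2 * p.1 ^ 2) / p.1 ^ 2) := by fun_prop
    exact h1.ennreal_ofReal

/-! ### The density and the tail of the covering radius -/

theorem continuous_ustinovDensity : Continuous ustinovDensity := by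
  have h30 : 0 < √(3 : ℝ) := Real.sqrt_pos.2 (by norm_num)
  have h3' : √(3 : ℝ) ^ 2 = 3 := Real.sq_sqrt (by norm_num)
  have h32 : √(3 : ℝ) ≤ 2 := by nlinarith
  have hlarge : ContinuousOn (fun R : ℝ => 12 / Real.pi ^ 2 *
      (R * √3 * Real.arccos ((R + 3 * √(R ^ 2 - 4)) / (4 * √(R ^ 2 - 3))) +
      3 / 2 * √(R ^ 2 - 4) * Real.log ((R ^ 2 - 4) / (R ^ 2 - 3)))) {R | 2 ≤ R} := by
    have hpos : ∀ R ∈ {R : ℝ | 2 ≤ R}, 0 < R ^ 2 - 3 := by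
      intro R hR
      have : (2 : ℝ) ≤ R := hR
      nlinarith
    have h1 : ContinuousOn (fun R : ℝ => 3 / 2 * √(R ^ 2 - 4) *
        Real.log ((R ^ 2 - 4) / (R ^ 2 - 3))) {R | 2 ≤ R} := by
      -- At $R=2$ the logarithm is singular, but $x\log x$ with $x=\sqrt{R^2-4}$ is continuous at
      -- $0$.
      have h2 : ContinuousOn (fun R : ℝ => 3 * (√(R ^ 2 - 4) * Real.log √(R ^ 2 - 4)) -
          3 / 2 * √(R ^ 2 - 4) * Real.log (R ^ 2 - 3)) {R | 2 ≤ R} := by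
        refine ContinuousOn.sub (Continuous.continuousOn ?_)
          (ContinuousOn.mul (Continuous.continuousOn (by fun_prop))
            (ContinuousOn.log (by fun_prop) fun R hR => (hpos R hR).ne'))
        exact continuous_const.mul (Real.continuous_mul_log.comp
          (show Continuous fun R : ℝ => √(R ^ 2 - 4) by fun_prop))
      refine h2.congr fun R hR => ?_
      have h2R : (2 : ℝ) ≤ R := hR
      have h3 := hpos R hR
      rcases eq_or_lt_of_le (show 0 ≤ R ^ 2 - 4 by nlinarith) with h | h
      · simp [← h]
      · have h4 : Real.log (R ^ 2 - 4) = 2 * Real.log √(R ^ 2 - 4) := by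
          rw [Real.log_sqrt h.le]; ring
        beta_reduce
        rw [Real.log_div h.ne' h3.ne', h4]
        ring
    refine continuousOn_const.mul (ContinuousOn.add (ContinuousOn.mul (by fun_prop) ?_) h1)
    refine Real.continuous_arccos.comp_continuousOn (ContinuousOn.div (by fun_prop) (by fun_prop) ?_)
    intro R hR
    have := Real.sqrt_pos.2 (hpos R hR)
    positivity
  have hmid : Continuous fun R : ℝ => 12 / Real.pi * (R / √3 - √(4 - R ^ 2)) := by fun_prop
  have hupper : Continuous fun R : ℝ => if R ≤ 2 then 12 / Real.pi * (R / √3 - √(4 - R ^ 2))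
      else 12 / Real.pi ^ 2 *
      (R * √3 * Real.arccos ((R + 3 * √(R ^ 2 - 4)) / (4 * √(R ^ 2 - 3))) +
      3 / 2 * √(R ^ 2 - 4) * Real.log ((R ^ 2 - 4) / (R ^ 2 - 3))) := by
    refine continuous_if_le continuous_id continuous_const hmid.continuousOn hlarge ?_
    rintro R rfl
    have h1 : Real.arccos (1 / 2) = Real.pi / 3 := by
      rw [← Real.cos_pi_div_three, Real.arccos_cos (by positivity) (by linarith [Real.pi_pos])]
    have h2 : ((2 : ℝ) + 3 * √(2 ^ 2 - 4)) / (4 * √(2 ^ 2 - 3)) = 1 / 2 := by norm_num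
    have h3 : √((2 : ℝ) ^ 2 - 4) = 0 := by norm_num
    have h4 : √(4 - (2 : ℝ) ^ 2) = 0 := by norm_num
    rw [h2, h1, h3, h4]
    have := Real.pi_pos
    field_simp
    linear_combination (-(4 * Real.pi)) * h3'
  refine continuous_if_le continuous_id continuous_const continuousOn_const hupper.continuousOn ?_
  rintro R rfl
  have h1 : √(4 - √(3 : ℝ) ^ 2) = 1 := by rw [h3']; norm_num
  rw [if_pos h32, h1, div_self h30.ne', sub_self, mul_zero]

theorem ustinovDensity_eq_zero {R : ℝ} (hR : R ≤ 0) : ustinovDensity R = 0 :=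
  if_pos (hR.trans (Real.sqrt_nonneg 3))

theorem reducedRadius_pos {g : SL(2, ℝ)} (hg : g ∈ reducedDomain) : 0 < reducedRadius g := by
  obtain ⟨⟨h1, h2⟩, ⟨h3, h4⟩, h5, h6⟩ := hg
  have := min_le_left (-g 1 0) (-g 0 1)
  simp only [reducedRadius]
  linarith

/-- Negative $R_0$ is needed for the two-sided derivative of the tail at $0$. -/
theorem sl2Haar_reducedRadius_gt_eq' (R₀ : ℝ) :
    sl2Haar (reducedDomain ∩ {g | R₀ < reducedRadius g}) =
      ENNReal.ofReal (Real.pi ^ 2 / 6) * ∫⁻ R in Set.Ioi R₀, ENNReal.ofReal (ustinovDensity R) := by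
  rcases le_or_gt 0 R₀ with h | h
  · exact sl2Haar_reducedRadius_gt_eq h
  · have h1 : reducedDomain ∩ {g | R₀ < reducedRadius g} =
        reducedDomain ∩ {g | 0 < reducedRadius g} := by
      ext g
      exact and_congr_right fun hg =>
        ⟨fun _ => reducedRadius_pos hg, fun _ => h.trans (reducedRadius_pos hg)⟩
    rw [h1, sl2Haar_reducedRadius_gt_eq le_rfl]
    congr 1
    refine (setLIntegral_eq_of_subset measurableSet_Ioi measurableSet_Ioi
      (Set.Ioi_subset_Ioi h.le) fun R hR => ?_).symm
    rw [ustinovDensity_eq_zero (not_lt.1 hR.2), ENNReal.ofReal_zero]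

namespace UnimodularLattice

theorem invariantMeasure_coveringRadius_gt (hinv : IsInvariantProbability invariantMeasure) (R : ℝ) :
    invariantMeasure {L : UnimodularLattice 2 | R < coveringRadius (cornerSimplex 2) L.lattice} =
      ∫⁻ x in Set.Ioi R, ENNReal.ofReal (ustinovDensity x) := by
  have hpi : 0 < Real.pi ^ 2 / 6 := by have := Real.pi_pos; positivity
  have h0 : sl2Haar reducedDomain ≠ 0 := by
    rw [sl2Haar_reducedDomain]; exact (ENNReal.ofReal_pos.2 hpi).ne'
  set C := reducedDomain ∩ {g | R < reducedRadius g} with hC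
  have hopen : IsOpen (orbitMap '' C) := isOpenQuotientMap_orbitMap.isOpenMap _
    (isOpen_reducedDomain.inter (isOpen_lt continuous_const continuous_reducedRadius))
  have hinj : ∀ g ∈ reducedDomain, (orbitMap g ∈ orbitMap '' C ↔ R < reducedRadius g) := by
    intro g hg
    constructor
    · rintro ⟨h, hh, heq⟩
      have : h = g := reducedDomain_injOn hh.1 hg ((smul_std_eq_smul_std_iff _ _).1 heq)
      exact this ▸ hh.2
    · exact fun h => ⟨g, ⟨hg, h⟩, rfl⟩
  -- Outside a null set every lattice has a reduced basis, so the event agrees almost everywhere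
  -- with an open set and no measurability of the covering radius is required.
  have hae : {L : UnimodularLattice 2 | R < coveringRadius (cornerSimplex 2) L.lattice}
      =ᵐ[invariantMeasure] orbitMap '' C := by
    filter_upwards [ae_mem_image_reducedDomain h0 hinv] with L hL
    obtain ⟨g, hg, rfl⟩ := hL
    refine propext (Iff.trans ?_ (hinj g hg).symm)
    change R < coveringRadius (cornerSimplex 2) (g • std 2).lattice ↔ _
    rw [coveringRadius_smul_std hg]
    rfl
  have hpre : orbitMap ⁻¹' (orbitMap '' C) ∩ reducedDomain = C := by
    ext g
    constructor
    · rintro ⟨h1, h2⟩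
      exact ⟨h2, (hinj g h2).1 h1⟩
    · rintro ⟨h1, h2⟩
      exact ⟨(hinj g h1).2 h2, h1⟩
  rw [measure_congr hae, invariantMeasure_apply hopen.measurableSet, hpre, hC,
    sl2Haar_reducedRadius_gt_eq', sl2Haar_reducedDomain, ← mul_assoc,
    ENNReal.inv_mul_cancel (ENNReal.ofReal_pos.2 hpi).ne' ENNReal.ofReal_ne_top, one_mul]

end UnimodularLattice

theorem mainTheorem11 :
    (∃! μ : Measure (UnimodularLattice 2), UnimodularLattice.IsInvariantProbability μ) ∧
    ∀ μ : Measure (UnimodularLattice 2), UnimodularLattice.IsInvariantProbability μ →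
      ∀ R : ℝ, 0 ≤ R →
        HasDerivAt (UnimodularLattice.coveringRadiusTail μ) (-ustinovDensity R) R ∧
        IntegrableOn ustinovDensity (Set.Ioi R) ∧
        UnimodularLattice.coveringRadiusTail μ R = ∫ x in Set.Ioi R, ustinovDensity x := by
  have hpi : 0 < Real.pi ^ 2 / 6 := by have := Real.pi_pos; positivity
  have h0 : sl2Haar reducedDomain ≠ 0 := by
    rw [sl2Haar_reducedDomain]; exact (ENNReal.ofReal_pos.2 hpi).ne'
  have htop : sl2Haar reducedDomain ≠ ⊤ := by
    rw [sl2Haar_reducedDomain]; exact ENNReal.ofReal_ne_top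
  have hinv := UnimodularLattice.isInvariantProbability_invariantMeasure h0 htop
  refine ⟨⟨_, hinv, fun ν hν => hν.eq_invariantMeasure h0 htop⟩, fun μ hμ R _ => ?_⟩
  obtain rfl := hμ.eq_invariantMeasure h0 htop
  have := hinv.1
  have hlint := UnimodularLattice.invariantMeasure_coveringRadius_gt hinv
  have hint : ∀ x, IntegrableOn ustinovDensity (Set.Ioi x) := by
    intro x
    refine ⟨continuous_ustinovDensity.aestronglyMeasurable, ?_⟩
    -- Integrability needs no asymptotics of the density: its integral is a probability.
    rw [hasFiniteIntegral_iff_ofReal (Filter.Eventually.of_forall ustinovDensity_nonneg), ← hlint x]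
    exact measure_lt_top _ _
  have htail : ∀ x, UnimodularLattice.coveringRadiusTail UnimodularLattice.invariantMeasure x =
      ∫ y in Set.Ioi x, ustinovDensity y := by
    intro x
    rw [integral_eq_lintegral_of_nonneg_ae (Filter.Eventually.of_forall ustinovDensity_nonneg)
      continuous_ustinovDensity.aestronglyMeasurable, ← hlint x]
    rfl
  refine ⟨?_, hint R, htail R⟩
  have hfun : UnimodularLattice.coveringRadiusTail UnimodularLattice.invariantMeasure =
      fun x => (∫ y in Set.Ioi (0 : ℝ), ustinovDensity y) - ∫ y in (0 : ℝ)..x, ustinovDensity y := by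
    ext1 x
    rw [htail x, ← intervalIntegral.integral_interval_add_Ioi (hint 0) (hint x)]
    ring
  rw [hfun]
  exact (continuous_ustinovDensity.integral_hasStrictDerivAt 0 R).hasDerivAt.const_sub _
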